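/- Let $(M,g)$ be a connected (finite-dimensional, Hausdorff, second countable) smooth Riemannian manifold without boundary, with Riemannian distance $d$ and Levi-Civita covariant derivative $\nabla$. For a smooth vector field $X$ on $M$ and $m\in M$ put $|X|_m=|X(m)|_g$ and $|\nabla X|_m=\sup\{|\nabla_vX|_g : v\in T_mM,\ |v|_g=1\}$. For a family of functions $\rho(s)=(\rho_m(s))_{m\in M}$ with $\rho_m(s)\ge 0$ put $|\rho|^*_t=\int_0^t\sup_{m\in M}\rho_m(s)\,ds\in[0,\infty]$; in particular $|Y|^*_t=\int_0^t\sup_m|Y_s|_m\,ds$ and $|\nabla Y|^*_t=\int_0^t\sup_m|\nabla Y_s|_m\,ds$. Let $J=[0,T]$ and let $J\ni t\mapsto X_t$ and $J\ni t\mapsto Y_t$ be two smooth time-dependent vector fields on $M$ (that is, $(t,m)\mapsto X_t(m)$ and $(t,m)\mapsto Y_t(m)$ are smooth on $J\times M$) which are complete: for every $s\in J$ and $m\in M$ there is a solution $\sigma:J\to M$ of $\dot\sigma(t)=X_t(\sigma(t))$ on $J$ (with one-sided derivatives at the end points) with $\sigma(s)=m$, and likewise for $Y$. Let $\mu^X$,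 $\mu^Y$ be the flows: $\mu^X_{t,s}(m)=\sigma(t)$ for the solution $\sigma$ with $\sigma(s)=m$, and likewise $\mu^Y$. Then for all $m\in M$ and $t\in(0,T]$, with values in $[0,\infty]$ and the conventions $e^\infty=\infty$ and $0\cdot\infty=0$, $$d\big(\mu^X_{t,0}(m),\mu^Y_{t,0}(m)\big)\le\int_0^t\exp\Big(\int_s^t|\nabla X_\sigma|_{\mu^X_{\sigma,s}(\mu^Y_{s,0}(m))}\,d\sigma\Big)\,|Y_s-X_s|_{\mu^Y_{s,0}(m)}\,ds\le e^{|\nabla X|^*_t}\,|Y-X|^*_t,$$ $$d\big(\mu^Y_{t,0}(m),m\big)\le\int_0^t|Y_s|_{\mu^Y_{s,0}(m)}\,ds\le|Y|^*_t,$$ $$d\big(\mu^Y_{t,0}(m),m\big)\le\int_0^t\exp\Big(\int_s^t|\nabla Y_\sigma|_{\mu^Y_{\sigma,s}(m)}\,d\sigma\Big)\,|Y_s|_m\,ds\le e^{|\nabla Y|^*_t}\int_0^t|Y_s|_m\,ds.$$ -/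

import Mathlib

open Set MeasureTheory
open scoped Manifold ContDiff ENNReal

noncomputable section FlowEstimates

variable {E : Type*} [NormedAddCommGroup E] [NormedSpace ℝ E]

/-- Given the derivative at a point of a metric `G` on the model space, `D u v w = ∂_u G(v, w)`, the
Christoffel symbols of the first kind: `w ↦ ½ (∂_u G(v, w) + ∂_v G(u, w) - ∂_w G(u, v))`. -/
def christoffelForm (D : E →L[ℝ] E →L[ℝ] E →L[ℝ] ℝ) (u v : E) : E →L[ℝ] ℝ :=
  (1 / 2 : ℝ) • (D u v + D v u - (D.flip u).flip v)

/-- The derivative at `y` of a map from the model space to the bilinear forms on it. -/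
def formDeriv (G : E → E →L[ℝ] E →L[ℝ] ℝ) (y : E) : E →L[ℝ] E →L[ℝ] E →L[ℝ] ℝ :=
  fderiv ℝ G y

variable {M : Type*} [TopologicalSpace M] [ChartedSpace E M] [IsManifold 𝓘(ℝ, E) ∞ M]

/-- A time dependent vector field `X_t ∈ Γ(TM)`, `t ∈ J`, is smoothly varying: `(t, m) ↦ X_t(m)` is
a smooth map `J × M → TM`. Values of `X` at times outside `J` are irrelevant. -/
def SmoothTimeDepField (J : Set ℝ) (X : ℝ → (m : M) → TangentSpace 𝓘(ℝ, E) m) : Prop :=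
  ContMDiffOn (𝓘(ℝ, ℝ).prod 𝓘(ℝ, E)) (𝓘(ℝ, E).prod 𝓘(ℝ, E)) ∞
    (fun p : ℝ × M ↦ (⟨p.2, X p.1 p.2⟩ : TangentBundle 𝓘(ℝ, E) M)) (J ×ˢ univ)

/-- `γ` solves `γ'(t) = X_t(γ(t))` for all `t ∈ J`, with one-sided derivatives at the endpoints
of `J`. Values of `γ` outside `J` are irrelevant. -/
def IsSolutionOn (J : Set ℝ) (X : ℝ → (m : M) → TangentSpace 𝓘(ℝ, E) m) (γ : ℝ → M) : Prop :=
  ∀ t ∈ J, HasMFDerivWithinAt 𝓘(ℝ, ℝ) 𝓘(ℝ, E) γ J t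
    ((1 : ℝ →L[ℝ] ℝ).smulRight (X t (γ t)))

/-- A time dependent vector field is complete: for all `s ∈ J` and `m ∈ M` there is a solution
on the whole of `J` passing through `m` at time `s`. -/
def CompleteTimeDepField (J : Set ℝ) (X : ℝ → (m : M) → TangentSpace 𝓘(ℝ, E) m) : Prop :=
  ∀ s ∈ J, ∀ m : M, ∃ γ : ℝ → M, IsSolutionOn J X γ ∧ γ s = m

open Classical in
/-- The flow `μ_{t,s}^X(m)`: the value at time `t` of the solution on `J` which passes through `m`
at time `s` (and the junk value `m` if there is no such solution). -/
def timeDepFlow (J : Set ℝ) (X : ℝ → (m : M) → TangentSpace 𝓘(ℝ, E) m) (t s : ℝ) (m : M) : M :=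
  if h : ∃ γ : ℝ → M, IsSolutionOn J X γ ∧ γ s = m then h.choose t else m

/-- The coordinate expression, in the preferred chart at `m`, of a vector field. -/
def chartField (m : M) (X : (x : M) → TangentSpace 𝓘(ℝ, E) x) (y : E) : E :=
  (trivializationAt E (TangentSpace 𝓘(ℝ, E)) m).continuousLinearMapAt ℝ
    ((extChartAt 𝓘(ℝ, E) m).symm y) (X ((extChartAt 𝓘(ℝ, E) m).symm y))

/-- The derivative `∂_v X` at `m` of the coordinate expression of `X` in the preferred chart at `m`.
Recall that the tangent space at `m` is identified with the model space by this chart. -/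
def chartDeriv (X : (x : M) → TangentSpace 𝓘(ℝ, E) x) (m : M) (v : TangentSpace 𝓘(ℝ, E) m) :
    TangentSpace 𝓘(ℝ, E) m :=
  fderiv ℝ (chartField m X) (extChartAt 𝓘(ℝ, E) m m) v

open Bundle

variable [RiemannianBundle (fun x : M ↦ TangentSpace 𝓘(ℝ, E) x)]

/-- The coordinate expression `y ↦ (g_{ij}(y))`, in the preferred chart at `m`, of the Riemannian
metric, as a bilinear form on the model space depending on `y`. -/
def chartMetric (m : M) (y : E) : E →L[ℝ] E →L[ℝ] ℝ :=
  (innerSL ℝ (E := TangentSpace 𝓘(ℝ, E) ((extChartAt 𝓘(ℝ, E) m).symm y))).bilinearComp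
    ((trivializationAt E (TangentSpace 𝓘(ℝ, E)) m).symmL ℝ ((extChartAt 𝓘(ℝ, E) m).symm y))
    ((trivializationAt E (TangentSpace 𝓘(ℝ, E)) m).symmL ℝ ((extChartAt 𝓘(ℝ, E) m).symm y))

variable [FiniteDimensional ℝ E]

/-- Tangent spaces are finite-dimensional, hence complete for the norm given by the metric. -/
instance tangentSpace_completeSpace (m : M) : CompleteSpace (TangentSpace 𝓘(ℝ, E) m) :=
  haveI : FiniteDimensional ℝ (TangentSpace 𝓘(ℝ, E) m) := inferInstanceAs (FiniteDimensional ℝ E)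
  FiniteDimensional.complete ℝ (TangentSpace 𝓘(ℝ, E) m)

/-- The Christoffel symbols of the second kind at `m`: the tangent vector `Γ(u, v)` with
`⟨Γ(u, v), w⟩ = ½ (∂_u g(v, w) + ∂_v g(u, w) - ∂_w g(u, v))` for all `w`, where the derivatives
are taken in the preferred chart at `m`. -/
def christoffel (m : M) (u v : TangentSpace 𝓘(ℝ, E) m) : TangentSpace 𝓘(ℝ, E) m :=
  (InnerProductSpace.toDual ℝ (TangentSpace 𝓘(ℝ, E) m)).symm
    (christoffelForm (E := E) (formDeriv (chartMetric m) (extChartAt 𝓘(ℝ, E) m m)) u v)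

/-- The Levi-Civita covariant derivative `∇_v X` of the vector field `X` in the direction
`v ∈ T_m M`, computed in the preferred chart at `m` as `∂_v X + Γ(v, X(m))`. -/
def leviCivita (X : (x : M) → TangentSpace 𝓘(ℝ, E) x) (m : M) (v : TangentSpace 𝓘(ℝ, E) m) :
    TangentSpace 𝓘(ℝ, E) m :=
  chartDeriv X m v + christoffel m v (X m)

/-- `|∇X|_m = sup_{|v| = 1} |∇_v X|`. -/
def nablaNorm (X : (x : M) → TangentSpace 𝓘(ℝ, E) x) (m : M) : ℝ≥0∞ :=
  ⨆ (v : TangentSpace 𝓘(ℝ, E) m) (_ : ‖v‖ = 1), ‖leviCivita X m v‖ₑ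

end FlowEstimates

open Bundle

/-- For `ρ_m(s) ≥ 0`, the quantity `|ρ|*_t = ∫_0^t sup_m ρ_m(s) ds`, which may be `∞`. -/
noncomputable def supIntegral {M : Type*} (ρ : ℝ → M → ℝ≥0∞) (t : ℝ) : ℝ≥0∞ :=
  ∫⁻ s in Icc 0 t, ⨆ m, ρ s m

/-- The exponential function `[0, ∞] → [0, ∞]`, with `exp ∞ = ∞`. -/
noncomputable def ennExp (x : ℝ≥0∞) : ℝ≥0∞ := EReal.exp (x : EReal)

/-!
Fix a final time `t` and let `p` be a `C^1` curve in `M`. Transporting the point `p s` from time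
`s` to time `t` by the flow `μ` of `X` gives a curve `s ↦ μ_{t,s}(p s)` from `μ_{t,0}(p 0)` to
`p t`, so its length bounds the distance of these two points. Its velocity is
`Dμ_{t,s}(p s) (p' s - X_s(p s))` (`contMDiffWithinAt_timeDepFlow_curve`): the flow cancels that
part of the velocity of `p` which is due to `X`. Moreover
`|Dμ_{t,s}(x) v| ≤ exp (∫_s^t |∇X_r|_{μ_{r,s}(x)} dr) |v|` (`enorm_mfderiv_timeDepFlow_le`), and
the two facts give the estimate `riemannianEDist_timeDepFlow_le`. For `p` the trajectory of `Y`, it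
is the comparison of the flows of `X` and `Y`; for a constant curve `p` and the field `Y`, it
bounds the displacement of a point by `|Y|` at that point. The other bound of the displacement is
the length of the trajectory of `Y`, and the bounds by suprema follow from monotonicity of the
integral.

The bound on the differential is Grönwall's inequality: for `w r = Dμ_{r,s}(x) v` one has
`d/dr |w r|² = 2 ⟨∇_{w r} X_r, w r⟩`. By the flow property it suffices to prove this at `r = s`,
where it is read off in the preferred chart from the variational equation. In that chart
`⟨∇_w X, w⟩ = ⟨∂_w X, w⟩ + ½ (∂_X g)(w, w)`, which is all that is needed of the connection
(`inner_leviCivita`). The Grönwall inequality `ofReal_le_ennExp_lintegral_mul` makes no assumption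
on the measurability or the finiteness of the integral of `|∇X|`.

That the flow is differentiable in the initial point rests on local flows in a chart
(`exists_isLocalFlow`), which are obtained from the Picard-Lindelöf theorem for the field extended
by its linearization. Their dependence on the initial time is handled by
`IsLocalFlow.hasDerivWithinAt_comp`, for initial points moving with the initial time. Time
derivatives at the endpoints of the interval are one-sided; for the local flow, times outside of
the interval are projected to it, so that its own time derivatives are two-sided.
-/

/-! ### Local flows of time-dependent Lipschitz fields -/

open Metric Filter Function Topology in
/-- Local flow of a time-dependent vector field `g` that is Lipschitz, jointly in time and space,
near `(s₀, w₀)` within `[a, b] × W`. The flow `Ψ r s w` (time `r`, starting from `w` at time `s`)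
is jointly continuous. It is obtained by applying the Picard-Lindelöf theorem to the autonomous
field `(1, g)` on `ℝ × W`, where times outside `[a, b]` are projected to `[a, b]`. -/
theorem exists_local_continuous_flow {W : Type*} [NormedAddCommGroup W] [NormedSpace ℝ W]
    [CompleteSpace W] {a b : ℝ} {s₀ : ℝ} (hs₀ : s₀ ∈ Icc a b) {w₀ : W} {g : ℝ → W → W}
    {K : NNReal} {S : Set (ℝ × W)} (hS : S ∈ 𝓝[Icc a b ×ˢ univ] (s₀, w₀))
    (hg : LipschitzOnWith K (uncurry g) S) {N : Set W} (hN : N ∈ 𝓝 w₀) :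
    ∃ δ > 0, ∃ ρ > 0, ∃ Ψ : ℝ → ℝ → W → W,
      (∀ s ∈ Icc a b ∩ ball s₀ δ, ∀ w ∈ ball w₀ ρ, Ψ s s w = w ∧
        ∀ r ∈ Icc a b ∩ ball s₀ δ, Ψ r s w ∈ N ∧ (r, Ψ r s w) ∈ S ∧
          HasDerivAt (fun τ ↦ Ψ τ s w) (g r (Ψ r s w)) r) ∧
      ContinuousOn (fun p : ℝ × ℝ × W ↦ Ψ p.1 p.2.1 p.2.2)
        ((Icc a b ∩ ball s₀ δ) ×ˢ (Icc a b ∩ ball s₀ δ) ×ˢ ball w₀ ρ) := by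
  have hab : a ≤ b := hs₀.1.trans hs₀.2
  obtain ⟨a₀, ha₀, hS⟩ := Metric.mem_nhdsWithin_iff.1 hS
  set P : ℝ → ℝ := fun τ ↦ projIcc a b hab τ with hP
  have hPmem (τ : ℝ) : P τ ∈ Icc a b := (projIcc a b hab τ).2
  have hPself {τ : ℝ} (h : τ ∈ Icc a b) : P τ = τ := by simp [hP, projIcc_of_mem hab h]
  have hPdist (τ τ' : ℝ) : dist (P τ) (P τ') ≤ dist τ τ' := by
    have := (LipschitzWith.projIcc hab).dist_le_mul τ τ'
    rwa [NNReal.coe_one, one_mul] at this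
  set z₀ : ℝ × W := (s₀, w₀) with hz₀
  set F : ℝ × W → ℝ × W := fun z ↦ (1, g (P z.1) z.2) with hF
  obtain ⟨r₁, hr₁, hr₁a⟩ : ∃ r₁ : NNReal, 0 < r₁ ∧ (r₁ : ℝ) < a₀ :=
    ⟨(a₀ / 2).toNNReal, by simpa using ha₀, by
      rw [Real.coe_toNNReal _ (by positivity)]; linarith⟩
  have hmem {z : ℝ × W} (hz : z ∈ closedBall z₀ r₁) : (P z.1, z.2) ∈ S := by
    refine hS ⟨?_, hPmem _, mem_univ _⟩
    have h1 := hPdist z.1 s₀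
    rw [hPself hs₀] at h1
    rw [mem_closedBall, Prod.dist_eq, max_le_iff] at hz
    rw [mem_ball, Prod.dist_eq, max_lt_iff]
    exact ⟨(h1.trans hz.1).trans_lt hr₁a, hz.2.trans_lt hr₁a⟩
  have hFlip : LipschitzOnWith K F (closedBall z₀ r₁) := by
    refine LipschitzOnWith.of_dist_le_mul fun z hz z' hz' ↦ ?_
    have h1 := hg.dist_le_mul _ (hmem hz) _ (hmem hz')
    have h2 : dist ((P z.1, z.2) : ℝ × W) (P z'.1, z'.2) ≤ dist z z' := by
      rw [Prod.dist_eq, Prod.dist_eq]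
      exact max_le_max (hPdist _ _) le_rfl
    have h3 : dist (F z) (F z') = dist (g (P z.1) z.2) (g (P z'.1) z'.2) := by
      simp [hF, Prod.dist_eq]
    rw [h3]
    exact h1.trans (by gcongr)
  set L : NNReal := ‖F z₀‖₊ + K * r₁ with hL
  have hFbd : ∀ z ∈ closedBall z₀ r₁, ‖F z‖ ≤ L := fun z hz ↦ by
    have h1 := hFlip.norm_sub_le hz (mem_closedBall_self r₁.2)
    have h2 : ‖z - z₀‖ ≤ r₁ := by simpa [dist_eq_norm] using hz
    calc ‖F z‖ ≤ ‖F z₀‖ + ‖F z - F z₀‖ := by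
          simpa using norm_add_le (F z₀) (F z - F z₀)
      _ ≤ ‖F z₀‖ + K * r₁ := by gcongr; exact h1.trans (by gcongr)
      _ = L := by simp [hL]
  set ε : ℝ := r₁ / (2 * (L + 1)) with hε
  have hr₁' : (0 : ℝ) < r₁ := hr₁
  have hεpos : 0 < ε := by positivity
  have hPL : IsPicardLindelof (fun _ ↦ F) (tmin := -ε) (tmax := ε)
      ⟨0, by simp [hεpos.le]⟩ z₀ r₁ (r₁ / 2) L K := by
    refine IsPicardLindelof.of_time_independent hFbd hFlip ?_
    simp only [sub_zero, zero_sub, neg_neg, max_self, NNReal.coe_div, NNReal.coe_ofNat]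
    have : (L : ℝ) * ε ≤ (L + 1) * ε := by gcongr; linarith
    have h2 : ((L : ℝ) + 1) * ε = r₁ / 2 := by rw [hε]; field_simp
    linarith
  obtain ⟨α, hα, hαc⟩ := hPL.exists_forall_mem_closedBall_eq_hasDerivWithinAt_continuousOn
  simp only [NNReal.coe_div, NNReal.coe_ofNat] at hα hαc
  have hz₀mem : z₀ ∈ closedBall z₀ ((r₁ : ℝ) / 2) := mem_closedBall_self (by positivity)
  have hfst {z : ℝ × W} (hz : z ∈ closedBall z₀ ((r₁ : ℝ) / 2)) {t : ℝ} (ht : t ∈ Icc (-ε) ε) :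
      (α (z, t)).1 = z.1 + t := by
    have h0 : (0 : ℝ) ∈ Icc (-ε) ε := by simp [hεpos.le]
    have := (convex_Icc (-ε) ε).norm_image_sub_le_of_norm_hasDerivWithin_le
      (f := fun t ↦ (α (z, t)).1 - t) (f' := fun _ ↦ 0) (C := 0) (x := 0) (y := t)
      (fun x hx ↦ by
        have h1 := ((hα z hz).2 x hx)
        have h2 : HasDerivWithinAt (fun t ↦ (α (z, t)).1) 1 (Icc (-ε) ε) x := by
          simpa [hF] using! ((hasFDerivAt_fst (𝕜 := ℝ)
            (p := α (z, x))).comp_hasDerivWithinAt x h1)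
        simpa using! h2.sub (hasDerivWithinAt_id x _)) (by simp) h0 ht
    have h3 : (α (z, 0)).1 = z.1 := by rw [(hα z hz).1]
    simp only [h3, sub_zero, zero_mul, norm_le_zero_iff] at this
    linarith
  -- by continuity, the local flow stays in the region where the hypotheses hold for a short time
  have hcat : ContinuousAt α (z₀, 0) := hαc.continuousAt
    (prod_mem_nhds (closedBall_mem_nhds _ (by positivity)) (Icc_mem_nhds (by simpa) hεpos))
  have hα0 : α (z₀, 0) = z₀ := (hα z₀ hz₀mem).1
  have hG : ball z₀ r₁ ∩ Prod.snd ⁻¹' N ∈ 𝓝 (α (z₀, 0)) := by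
    rw [hα0]
    exact inter_mem (ball_mem_nhds _ hr₁) (continuous_snd.continuousAt hN)
  obtain ⟨η₀, hη₀, hη₀G⟩ := Metric.mem_nhds_iff.1 (hcat hG)
  set η : ℝ := min η₀ (min (r₁ / 2) ε) with hη
  have hηpos : 0 < η := by positivity
  have key {s r : ℝ} (hs : s ∈ Icc a b ∩ ball s₀ (η / 2)) (hr : r ∈ Icc a b ∩ ball s₀ (η / 2))
      {w : W} (hw : w ∈ ball w₀ η) :
      ((s, w) : ℝ × W) ∈ closedBall z₀ ((r₁ : ℝ) / 2) ∧ r - s ∈ Ioo (-ε) ε ∧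
        (((s, w), r - s) : (ℝ × W) × ℝ) ∈ ball (z₀, 0) η₀ := by
    have hs2 := mem_ball.1 hs.2
    have hr2 := mem_ball.1 hr.2
    have hw2 := mem_ball.1 hw
    have h1 : η ≤ η₀ := min_le_left _ _
    have h2 : η ≤ r₁ / 2 := (min_le_right _ _).trans (min_le_left _ _)
    have h3 : η ≤ ε := (min_le_right _ _).trans (min_le_right _ _)
    have h4 : |r - s| < η := by
      rw [Real.dist_eq] at hs2 hr2
      calc |r - s| = |(r - s₀) - (s - s₀)| := by ring_nf
        _ ≤ |r - s₀| + |s - s₀| := abs_sub _ _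
        _ < η := by linarith
    refine ⟨?_, ⟨by linarith [(abs_lt.1 h4).1], by linarith [(abs_lt.1 h4).2]⟩, ?_⟩
    · rw [mem_closedBall, Prod.dist_eq]
      exact max_le (by linarith) (by linarith)
    · rw [mem_ball, Prod.dist_eq, Prod.dist_eq]
      refine max_lt (max_lt (by linarith) (by linarith)) ?_
      simpa using h4.trans_le h1
  refine ⟨η / 2, by positivity, η, hηpos, fun r s w ↦ (α ((s, w), r - s)).2,
    fun s hs w hw ↦ ⟨?_, fun r hr ↦ ?_⟩, ?_⟩
  · have h1 := (key hs hs hw).1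
    simp [(hα _ h1).1]
  · obtain ⟨h1, h2, h3⟩ := key hs hr hw
    have h4 := hη₀G h3
    have h5 : (α ((s, w), r - s)).1 = r := by
      rw [hfst h1 (Ioo_subset_Icc_self h2)]; ring
    have h6 := hmem (ball_subset_closedBall h4.1)
    rw [h5, hPself hr.1] at h6
    refine ⟨h4.2, h6, ?_⟩
    have h7 := ((hα _ h1).2 _ (Ioo_subset_Icc_self h2)).hasDerivAt (Icc_mem_nhds h2.1 h2.2)
    have h8 := h7.comp_sub_const r s
    have h9 := (hasFDerivAt_snd (𝕜 := ℝ) (p := α ((s, w), r - s))).comp_hasDerivAt r h8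
    simpa [hF, h5, hPself hr.1, Function.comp_def] using h9
  · refine continuous_snd.comp_continuousOn (hαc.comp (f := fun p : ℝ × ℝ × W ↦
      ((p.2.1, p.2.2), p.1 - p.2.1)) (by fun_prop) ?_)
    rintro ⟨r, s, w⟩ ⟨hr, hs, hw⟩
    obtain ⟨h1, h2, -⟩ := key hs hr hw
    exact ⟨h1, Ioo_subset_Icc_self h2⟩

/-! ### Differentiability of local flows on a normed space -/

/-- Two-sided form of Grönwall's inequality: on an interval containing `s`, the bound
`‖f'‖ ≤ K ‖f‖ + ε` controls `f` before `s` as well as after `s`. -/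
theorem norm_le_gronwallBound_abs_sub {E : Type*} [NormedAddCommGroup E] [NormedSpace ℝ E]
    {S : Set ℝ} (hS : S.OrdConnected) {f f' : ℝ → E} {K ε : ℝ}
    (hf : ∀ r ∈ S, HasDerivWithinAt f (f' r) S r) (bound : ∀ r ∈ S, ‖f' r‖ ≤ K * ‖f r‖ + ε)
    {s r : ℝ} (hs : s ∈ S) (hr : r ∈ S) : ‖f r‖ ≤ gronwallBound ‖f s‖ K ε |r - s| := by
  rcases le_total s r with hsr | hsr
  · have hsub : Icc s r ⊆ S := hS.out hs hr
    rw [abs_of_nonneg (sub_nonneg.2 hsr)]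
    refine norm_le_gronwallBound_of_norm_deriv_right_le
      (fun x hx ↦ ((hf x (hsub hx)).mono hsub).continuousWithinAt)
      (fun x hx ↦ ((hf x (hsub (Ico_subset_Icc_self hx))).mono hsub).mono_of_mem_nhdsWithin
        (Icc_mem_nhdsGE_of_mem hx)) le_rfl
      (fun x hx ↦ bound x (hsub (Ico_subset_Icc_self hx))) r ⟨hsr, le_rfl⟩
  · have hsub : Icc r s ⊆ S := hS.out hr hs
    have hneg {x : ℝ} (hx : x ∈ Icc (-s) (-r)) : -x ∈ Icc r s :=
      ⟨by linarith [hx.2], by linarith [hx.1]⟩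
    have hd (x : ℝ) (hx : x ∈ Icc (-s) (-r)) :
        HasDerivWithinAt (fun x ↦ f (-x)) (-f' (-x)) (Icc (-s) (-r)) x := by
      simpa using! ((hf _ (hsub (hneg hx))).mono hsub).scomp x
        (hasDerivWithinAt_neg x (Icc (-s) (-r))) (fun y hy ↦ hneg hy)
    have := norm_le_gronwallBound_of_norm_deriv_right_le (f := fun x ↦ f (-x))
      (f' := fun x ↦ -f' (-x)) (a := -s) (b := -r) (δ := ‖f s‖) (K := K) (ε := ε)
      (fun x hx ↦ (hd x hx).continuousWithinAt)
      (fun x hx ↦ (hd x (Ico_subset_Icc_self hx)).mono_of_mem_nhdsWithin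
        (Icc_mem_nhdsGE_of_mem hx)) (by simp)
      (fun x hx ↦ by simpa using bound (-x) (hsub (hneg (Ico_subset_Icc_self hx))))
      (-r) ⟨by linarith, le_rfl⟩
    rw [abs_of_nonpos (sub_nonpos.2 hsr)]
    simpa [add_comm, sub_eq_add_neg] using this

theorem gronwallBound_zero_mul_right (K ε c x : ℝ) :
    gronwallBound 0 K (ε * c) x = ε * gronwallBound 0 K c x := by
  unfold gronwallBound
  split_ifs
  · ring
  · ring

/-- `Φ r s y` is the flow from time `s` to time `r` of the time-dependent vector field `f` on a
normed space, for times in `J` and initial points in `B`, with values in `U`, and `V r s y` is its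
derivative in `y`, which solves the variational equation. -/
structure IsLocalFlow {E : Type*} [NormedAddCommGroup E] [NormedSpace ℝ E] (J : Set ℝ)
    (B U : Set E) (f : ℝ → E → E) (Φ : ℝ → ℝ → E → E) (V : ℝ → ℝ → E → E →L[ℝ] E) : Prop where
  apply_self : ∀ s ∈ J, ∀ y ∈ B, Φ s s y = y
  deriv_self : ∀ s ∈ J, ∀ y ∈ B, V s s y = ContinuousLinearMap.id ℝ E
  mem : ∀ r ∈ J, ∀ s ∈ J, ∀ y ∈ B, Φ r s y ∈ U
  hasDerivAt : ∀ r ∈ J, ∀ s ∈ J, ∀ y ∈ B, HasDerivAt (fun τ ↦ Φ τ s y) (f r (Φ r s y)) r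
  hasDerivAt_deriv : ∀ r ∈ J, ∀ s ∈ J, ∀ y ∈ B,
    HasDerivAt (fun τ ↦ V τ s y) (fderiv ℝ (f r) (Φ r s y) ∘L V r s y) r
  hasFDerivAt : ∀ r ∈ J, ∀ s ∈ J, ∀ y ∈ B, HasFDerivAt (Φ r s) (V r s y) y
  continuousOn : ContinuousOn (fun p : ℝ × ℝ × E ↦ Φ p.1 p.2.1 p.2.2) (J ×ˢ J ×ˢ B)
  continuousOn_deriv : ContinuousOn (fun p : ℝ × ℝ × E ↦ V p.1 p.2.1 p.2.2) (J ×ˢ J ×ˢ B)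
  comp : ∀ r ∈ J, ∀ s' ∈ J, ∀ s ∈ J, ∀ y ∈ B, Φ s' s y ∈ B → Φ r s' (Φ s' s y) = Φ r s y

section FDerivInSpace

variable {E : Type*} [NormedAddCommGroup E] [NormedSpace ℝ E] {J : Set ℝ} {U : Set E}
  {f : ℝ → E → E}

theorem hasFDerivAt_of_contDiffOn_uncurry (hU : IsOpen U)
    (hf : ContDiffOn ℝ ∞ (Function.uncurry f) (J ×ˢ U)) {τ : ℝ} (hτ : τ ∈ J) {y : E}
    (hy : y ∈ U) : HasFDerivAt (f τ)
      ((fderivWithin ℝ (Function.uncurry f) (J ×ˢ U) (τ, y)).comp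
        (ContinuousLinearMap.inr ℝ ℝ E)) y := by
  have h1 := ((hf (τ, y) ⟨hτ, hy⟩).differentiableWithinAt (by simp)).hasFDerivWithinAt
  have h2 : HasFDerivWithinAt (fun x : E ↦ (τ, x)) (ContinuousLinearMap.inr ℝ ℝ E) U y :=
    (hasFDerivAt_prodMk_right τ y).hasFDerivWithinAt
  exact (h1.comp y h2 fun x hx ↦ ⟨hτ, hx⟩).hasFDerivAt (hU.mem_nhds hy)

/-- The derivative in space of a jointly smooth map is jointly `C^1`. -/
theorem contDiffOn_fderiv_space (hJ : UniqueDiffOn ℝ J) (hU : IsOpen U)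
    (hf : ContDiffOn ℝ ∞ (Function.uncurry f) (J ×ˢ U)) :
    ContDiffOn ℝ 1 (fun p : ℝ × E ↦ fderiv ℝ (f p.1) p.2) (J ×ˢ U) := by
  have h1 : ContDiffOn ℝ 1 (fderivWithin ℝ (Function.uncurry f) (J ×ˢ U)) (J ×ˢ U) :=
    hf.fderivWithin (hJ.prod hU.uniqueDiffOn) (by norm_cast)
  refine (h1.clm_comp (contDiffOn_const (c := ContinuousLinearMap.inr ℝ ℝ E))).congr ?_
  rintro ⟨τ, y⟩ ⟨hτ, hy⟩
  exact (hasFDerivAt_of_contDiffOn_uncurry hU hf hτ hy).fderiv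

end FDerivInSpace

open Metric Filter Function Topology in
/-- Smooth time-dependent vector fields on a finite-dimensional space have local flows which are
`C^1` in the initial point. The flow and its derivative come as the flow of the field
`(f, D f ∘ L)` on pairs `(y, L)`; that the second component is the derivative of the first one is
Grönwall's inequality applied to the remainder of the first-order expansion. -/
theorem exists_isLocalFlow {E : Type*} [NormedAddCommGroup E] [NormedSpace ℝ E]
    [FiniteDimensional ℝ E] {a b s₀ : ℝ} (hab : a < b) (hs₀ : s₀ ∈ Icc a b) {U : Set E}
    (hU : IsOpen U) {y₀ : E} (hy₀ : y₀ ∈ U) {f : ℝ → E → E}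
    (hf : ContDiffOn ℝ ∞ (uncurry f) (Icc a b ×ˢ U)) :
    ∃ δ > 0, ∃ ρ > 0, ∃ Φ V,
      ball y₀ ρ ⊆ U ∧ IsLocalFlow (Icc a b ∩ ball s₀ δ) (ball y₀ ρ) U f Φ V := by
  have : CompleteSpace E := FiniteDimensional.complete ℝ E
  set J := Icc a b with hJ
  have hDf := contDiffOn_fderiv_space (uniqueDiffOn_Icc hab) hU hf
  set g : ℝ → E × (E →L[ℝ] E) → E × (E →L[ℝ] E) :=
    fun τ w ↦ (f τ w.1, (fderiv ℝ (f τ) w.1).comp w.2) with hg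
  set w₀ : E × (E →L[ℝ] E) := (y₀, ContinuousLinearMap.id ℝ E) with hw₀
  obtain ⟨r₀, hr₀, hr₀U⟩ := Metric.isOpen_iff.1 hU y₀ hy₀
  have hgC : ContDiffOn ℝ 1 (uncurry g)
      (J ×ˢ (ball y₀ r₀ ×ˢ (univ : Set (E →L[ℝ] E)))) := by
    have hproj : ContDiffOn ℝ 1 (fun p : ℝ × E × (E →L[ℝ] E) ↦ (p.1, p.2.1))
        (J ×ˢ (ball y₀ r₀ ×ˢ (univ : Set (E →L[ℝ] E)))) := by fun_prop
    have hmaps : MapsTo (fun p : ℝ × E × (E →L[ℝ] E) ↦ (p.1, p.2.1))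
        (J ×ˢ (ball y₀ r₀ ×ˢ (univ : Set (E →L[ℝ] E)))) (J ×ˢ U) :=
      fun p hp ↦ ⟨hp.1, hr₀U hp.2.1⟩
    exact ((hf.of_le (by norm_cast)).comp hproj hmaps).prodMk
      ((hDf.comp hproj hmaps).clm_comp (by fun_prop))
  obtain ⟨K, S, hS, hgS⟩ :=
    (hgC (s₀, w₀) ⟨hs₀, mem_ball_self hr₀, mem_univ _⟩).exists_lipschitzOnWith
    ((convex_Icc a b).prod ((convex_ball _ _).prod convex_univ))
  have hS' : S ∈ 𝓝[J ×ˢ univ] (s₀, w₀) := by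
    rw [nhdsWithin_prod_eq, nhdsWithin_prod_eq, nhdsWithin_univ,
      (isOpen_ball).nhdsWithin_eq (mem_ball_self hr₀)] at hS
    rwa [nhdsWithin_prod_eq, nhdsWithin_univ, hw₀, nhds_prod_eq]
  obtain ⟨ρ₀, hρ₀, hρ₀S⟩ := Metric.mem_nhdsWithin_iff.1 hS'
  set ρ₁ := min ρ₀ r₀ with hρ₁
  have hρ₁pos : 0 < ρ₁ := by positivity
  have hmemS {τ : ℝ} (hτ : τ ∈ J ∩ ball s₀ ρ₁) {y : E} (hy : y ∈ ball y₀ ρ₁) :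
      ((τ, (y, ContinuousLinearMap.id ℝ E)) : ℝ × E × (E →L[ℝ] E)) ∈ S := by
    refine hρ₀S ⟨?_, hτ.1, mem_univ _⟩
    have h1 := (mem_ball.1 hτ.2).trans_le (min_le_left ρ₀ r₀)
    have h2 := (mem_ball.1 hy).trans_le (min_le_left ρ₀ r₀)
    simp only [mem_ball, Prod.dist_eq, hw₀, dist_self, max_lt_iff]
    exact ⟨h1, h2, hρ₀⟩
  have hdist {τ : ℝ} (hτ : τ ∈ J ∩ ball s₀ ρ₁) {y y' : E} (hy : y ∈ ball y₀ ρ₁)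
      (hy' : y' ∈ ball y₀ ρ₁) : dist (f τ y) (f τ y') ≤ K * dist y y' ∧
        dist (fderiv ℝ (f τ) y) (fderiv ℝ (f τ) y') ≤ K * dist y y' := by
    have h1 := hgS.dist_le_mul _ (hmemS hτ hy) _ (hmemS hτ hy')
    simpa [hg, uncurry, Prod.dist_eq, dist_nonneg] using h1
  have hball : ball y₀ ρ₁ ⊆ U := (ball_subset_ball (min_le_right _ _)).trans hr₀U
  obtain ⟨δ₀, hδ₀, ρ, hρ, Ψ, hΨ, hΨc⟩ := exists_local_continuous_flow hs₀ hS' hgS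
    (N := ball y₀ ρ₁ ×ˢ univ) (prod_mem_nhds (ball_mem_nhds _ hρ₁pos) univ_mem)
  set δ := min δ₀ ρ₁ with hδ
  set B := ball y₀ (min ρ ρ₁) with hB
  have hJsub : J ∩ ball s₀ δ ⊆ J ∩ ball s₀ δ₀ :=
    inter_subset_inter_right _ (ball_subset_ball (min_le_left _ _))
  have hJsub' : J ∩ ball s₀ δ ⊆ J ∩ ball s₀ ρ₁ :=
    inter_subset_inter_right _ (ball_subset_ball (min_le_right _ _))
  have hBsub : B ⊆ ball y₀ ρ₁ := ball_subset_ball (min_le_right _ _)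
  have hBw {y : E} (hy : y ∈ B) : ((y, ContinuousLinearMap.id ℝ E) : E × (E →L[ℝ] E)) ∈
      ball w₀ ρ := by
    simp only [mem_ball, Prod.dist_eq, hw₀, dist_self, max_lt_iff]
    exact ⟨(mem_ball.1 hy).trans_le (min_le_left _ _), hρ⟩
  set Φ : ℝ → ℝ → E → E := fun r s y ↦ (Ψ r s (y, ContinuousLinearMap.id ℝ E)).1 with hΦ
  set V : ℝ → ℝ → E → E →L[ℝ] E := fun r s y ↦ (Ψ r s (y, ContinuousLinearMap.id ℝ E)).2 with hV
  have hord : (J ∩ ball s₀ δ).OrdConnected :=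
    (ordConnected_Icc).inter (convex_ball s₀ δ).ordConnected
  have hΦmem {r s : ℝ} (hr : r ∈ J ∩ ball s₀ δ) (hs : s ∈ J ∩ ball s₀ δ) {y : E} (hy : y ∈ B) :
      Φ r s y ∈ ball y₀ ρ₁ := ((hΨ s (hJsub hs) _ (hBw hy)).2 r (hJsub hr)).1.1
  have hΦder {r s : ℝ} (hr : r ∈ J ∩ ball s₀ δ) (hs : s ∈ J ∩ ball s₀ δ) {y : E} (hy : y ∈ B) :
      HasDerivAt (fun τ ↦ Φ τ s y) (f r (Φ r s y)) r := by
    have h := (hasFDerivAt_fst (𝕜 := ℝ)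
      (p := Ψ r s (y, ContinuousLinearMap.id ℝ E))).comp_hasDerivAt r
      ((hΨ s (hJsub hs) _ (hBw hy)).2 r (hJsub hr)).2.2
    exact h
  have hVder {r s : ℝ} (hr : r ∈ J ∩ ball s₀ δ) (hs : s ∈ J ∩ ball s₀ δ) {y : E} (hy : y ∈ B) :
      HasDerivAt (fun τ ↦ V τ s y) (fderiv ℝ (f r) (Φ r s y) ∘L V r s y) r := by
    have h := (hasFDerivAt_snd (𝕜 := ℝ)
      (p := Ψ r s (y, ContinuousLinearMap.id ℝ E))).comp_hasDerivAt r
      ((hΨ s (hJsub hs) _ (hBw hy)).2 r (hJsub hr)).2.2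
    exact h
  have hΦself {s : ℝ} (hs : s ∈ J ∩ ball s₀ δ) {y : E} (hy : y ∈ B) : Φ s s y = y :=
    congrArg Prod.fst (hΨ s (hJsub hs) _ (hBw hy)).1
  have hVself {s : ℝ} (hs : s ∈ J ∩ ball s₀ δ) {y : E} (hy : y ∈ B) :
      V s s y = ContinuousLinearMap.id ℝ E := congrArg Prod.snd (hΨ s (hJsub hs) _ (hBw hy)).1
  have hcont : ContinuousOn (fun p : ℝ × ℝ × E ↦ Ψ p.1 p.2.1 (p.2.2, ContinuousLinearMap.id ℝ E))
      ((J ∩ ball s₀ δ) ×ˢ (J ∩ ball s₀ δ) ×ˢ B) :=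
    hΨc.comp (f := fun p : ℝ × ℝ × E ↦ (p.1, p.2.1, (p.2.2, ContinuousLinearMap.id ℝ E)))
      (by fun_prop) fun p hp ↦ ⟨hJsub hp.1, hJsub hp.2.1, hBw hp.2.2⟩
  refine ⟨δ, by positivity, min ρ ρ₁, by positivity, Φ, V, hBsub.trans hball, ?_⟩
  refine ⟨fun s hs y hy ↦ hΦself hs hy, fun s hs y hy ↦ hVself hs hy,
    fun r hr s hs y hy ↦ hball (hΦmem hr hs hy), fun r hr s hs y hy ↦ hΦder hr hs hy,
    fun r hr s hs y hy ↦ hVder hr hs hy, fun r hr s hs y hy ↦ ?_,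
    continuous_fst.comp_continuousOn hcont, continuous_snd.comp_continuousOn hcont,
    fun r hr s' hs' s hs y hy hy' ↦ ?_⟩
  · -- the flow is Lipschitz in the initial point
    have hlip {τ : ℝ} (hτ : τ ∈ J ∩ ball s₀ δ) {y' : E} (hy' : y' ∈ B) :
        ‖Φ τ s y' - Φ τ s y‖ ≤ Real.exp (K * (2 * δ)) * ‖y' - y‖ := by
      have h1 := norm_le_gronwallBound_abs_sub hord (f := fun τ ↦ Φ τ s y' - Φ τ s y)
        (f' := fun τ ↦ f τ (Φ τ s y') - f τ (Φ τ s y)) (K := K) (ε := 0)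
        (fun x hx ↦ ((hΦder hx hs hy').sub (hΦder hx hs hy)).hasDerivWithinAt)
        (fun x hx ↦ by simpa [dist_eq_norm] using
          (hdist (hJsub' hx) (hΦmem hx hs hy') (hΦmem hx hs hy)).1) hs hτ
      rw [hΦself hs hy, hΦself hs hy', gronwallBound_ε0, mul_comm] at h1
      refine h1.trans ?_
      have h2 : |τ - s| ≤ 2 * δ := by
        have h3 := mem_ball.1 hτ.2
        have h4 := mem_ball.1 hs.2
        have := dist_triangle_right τ s s₀
        rw [← Real.dist_eq]
        linarith
      gcongr
    set C := Real.exp (K * (2 * δ)) with hC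
    -- the remainder of the first-order expansion solves a linear equation, up to a quadratic error
    have hrem (y' : E) (hy' : y' ∈ B) :
        ‖Φ r s y' - Φ r s y - V r s y (y' - y)‖ ≤
          (K * C ^ 2) * gronwallBound 0 K 1 |r - s| * ‖y' - y‖ ^ 2 := by
      have h1 := norm_le_gronwallBound_abs_sub hord
        (f := fun τ ↦ Φ τ s y' - Φ τ s y - V τ s y (y' - y))
        (f' := fun τ ↦ f τ (Φ τ s y') - f τ (Φ τ s y) -
          (fderiv ℝ (f τ) (Φ τ s y) ∘L V τ s y) (y' - y)) (K := K)
        (ε := (K * C ^ 2 * ‖y' - y‖ ^ 2) * 1)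
        (fun x hx ↦ (((hΦder hx hs hy').sub (hΦder hx hs hy)).sub
          ((hVder hx hs hy).clm_apply (hasDerivAt_const x (y' - y)))).hasDerivWithinAt.congr_deriv
            (by simp)) (fun τ hτ ↦ ?_) hs hr
      · rw [hΦself hs hy, hΦself hs hy', hVself hs hy] at h1
        simp only [ContinuousLinearMap.id_apply, sub_self, norm_zero] at h1
        rw [gronwallBound_zero_mul_right] at h1
        linarith
      · have hm := hΦmem hτ hs hy
        have hm' := hΦmem hτ hs hy'
        have h2 : ‖f τ (Φ τ s y') - f τ (Φ τ s y) -
            fderiv ℝ (f τ) (Φ τ s y) (Φ τ s y' - Φ τ s y)‖ ≤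
            (K * ‖Φ τ s y' - Φ τ s y‖) * ‖Φ τ s y' - Φ τ s y‖ := by
          have hseg : segment ℝ (Φ τ s y) (Φ τ s y') ⊆ ball y₀ ρ₁ :=
            (convex_ball _ _).segment_subset hm hm'
          refine Convex.norm_image_sub_le_of_norm_hasFDerivWithin_le'
            (s := segment ℝ (Φ τ s y) (Φ τ s y')) (f' := fderiv ℝ (f τ)) (fun x hx ↦ ?_)
            (fun x hx ↦ ?_) (convex_segment _ _) (left_mem_segment _ _ _) (right_mem_segment _ _ _)
          · exact (hasFDerivAt_of_contDiffOn_uncurry hU hf hτ.1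
              (hball (hseg hx))).differentiableAt.hasFDerivAt.hasFDerivWithinAt
          · have h3 := (hdist (hJsub' hτ) (hseg hx) hm).2
            rw [dist_eq_norm, dist_eq_norm] at h3
            exact h3.trans (by gcongr; exact norm_sub_le_of_mem_segment hx)
        have h3 : ‖fderiv ℝ (f τ) (Φ τ s y)‖ ≤ K :=
          norm_fderiv_le_of_lipschitzOn ℝ (isOpen_ball.mem_nhds hm)
            (LipschitzOnWith.of_dist_le_mul fun x hx x' hx' ↦ (hdist (hJsub' hτ) hx hx').1)
        have h4 := hlip hτ hy'
        calc _ = ‖(f τ (Φ τ s y') - f τ (Φ τ s y) -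
              fderiv ℝ (f τ) (Φ τ s y) (Φ τ s y' - Φ τ s y)) +
              fderiv ℝ (f τ) (Φ τ s y) (Φ τ s y' - Φ τ s y - V τ s y (y' - y))‖ := by
                congr 1
                simp only [ContinuousLinearMap.comp_apply, map_sub]
                abel
          _ ≤ (K * ‖Φ τ s y' - Φ τ s y‖) * ‖Φ τ s y' - Φ τ s y‖ +
              K * ‖Φ τ s y' - Φ τ s y - V τ s y (y' - y)‖ :=
            (norm_add_le _ _).trans (add_le_add h2 (ContinuousLinearMap.le_of_opNorm_le _ h3 _))
          _ ≤ (K * (C * ‖y' - y‖)) * (C * ‖y' - y‖) +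
              K * ‖Φ τ s y' - Φ τ s y - V τ s y (y' - y)‖ := by gcongr
          _ = _ := by ring
    have hO : (fun y' ↦ Φ r s y' - Φ r s y - V r s y (y' - y)) =O[𝓝 y]
        fun y' ↦ ‖y' - y‖ ^ 2 := by
      refine Asymptotics.IsBigO.of_bound ((K * C ^ 2) * gronwallBound 0 K 1 |r - s|) ?_
      filter_upwards [isOpen_ball.mem_nhds hy] with y' hy'
      rw [norm_pow, norm_norm]
      exact hrem y' hy'
    refine HasFDerivAt.of_isLittleO (hO.trans_isLittleO ?_)
    exact (Asymptotics.isLittleO_norm_pow_id (one_lt_two)).comp_tendsto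
      (tendsto_sub_nhds_zero_iff.2 tendsto_id)
  · -- the flow property is the uniqueness of solutions
    have h1 := norm_le_gronwallBound_abs_sub hord
      (f := fun τ ↦ Φ τ s' (Φ s' s y) - Φ τ s y)
      (f' := fun τ ↦ f τ (Φ τ s' (Φ s' s y)) - f τ (Φ τ s y)) (K := K) (ε := 0)
      (fun x hx ↦ ((hΦder hx hs' hy').sub (hΦder hx hs hy)).hasDerivWithinAt)
      (fun x hx ↦ by simpa [dist_eq_norm] using
        (hdist (hJsub' hx) (hΦmem hx hs' hy') (hΦmem hx hs hy)).1) hs' hr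
    rw [hΦself hs' hy', sub_self, norm_zero, gronwallBound_ε0_δ0] at h1
    exact sub_eq_zero.1 (norm_le_zero_iff.1 h1)

namespace IsLocalFlow

open Filter Topology Metric

variable {E : Type*} [NormedAddCommGroup E] [NormedSpace ℝ E] {J : Set ℝ} {B U : Set E}
  {f : ℝ → E → E} {Φ : ℝ → ℝ → E → E} {V : ℝ → ℝ → E → E →L[ℝ] E}

theorem contDiffOn (h : IsLocalFlow J B U f Φ V) (hB : IsOpen B) {r s : ℝ} (hr : r ∈ J)
    (hs : s ∈ J) : ContDiffOn ℝ 1 (Φ r s) B := by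
  rw [show (1 : WithTop ℕ∞) = 0 + 1 from rfl, contDiffOn_succ_iff_fderiv_of_isOpen hB]
  refine ⟨fun y hy ↦ (h.hasFDerivAt r hr s hs y hy).differentiableAt.differentiableWithinAt,
    by simp, ?_⟩
  rw [contDiffOn_zero]
  have h1 : ContinuousOn (V r s) B :=
    h.continuousOn_deriv.comp (f := fun y : E ↦ (r, s, y)) (by fun_prop) fun y hy ↦ ⟨hr, hs, hy⟩
  exact h1.congr fun y hy ↦ (h.hasFDerivAt r hr s hs y hy).fderiv

/-- Transporting a moving point `p s` from time `s` to the fixed time `r` by the flow gives a curve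
whose velocity is the transport of the difference between the velocity of `p` and the field. -/
theorem hasDerivWithinAt_comp (h : IsLocalFlow J B U f Φ V) (hJ : J.OrdConnected) (hB : IsOpen B)
    (hf : ContinuousOn (Function.uncurry f) (J ×ˢ U)) {p : ℝ → E} {r s : ℝ}
    (hr : r ∈ J) (hs : s ∈ J) (hpB : p s ∈ B) {p' : E} (hp : HasDerivWithinAt p p' J s) :
    HasDerivWithinAt (fun τ ↦ Φ r τ (p τ)) (V r s (p s) (p' - f s (p s))) J s := by
  have hevB : ∀ᶠ τ in 𝓝[J] s, p τ ∈ B := hp.continuousWithinAt (hB.mem_nhds hpB)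
  -- the displacement of `p τ` by the flow from time `τ` to time `s`
  have hdisp : HasDerivWithinAt (fun τ ↦ Φ s τ (p τ) - p τ) (-f s (p s)) J s := by
    rw [hasDerivWithinAt_iff_isLittleO, Asymptotics.isLittleO_iff]
    intro ε hε
    -- the velocity of `x ↦ Φ x τ (p τ)` between the times `τ` and `s` is close to `f s (p s)`
    have hcont : ContinuousWithinAt (fun q : ℝ × ℝ ↦ f q.1 (Φ q.1 q.2 (p q.2)))
        (J ×ˢ J) (s, s) := by
      have hpc : ContinuousWithinAt (fun q : ℝ × ℝ ↦ p q.2) (J ×ˢ J) (s, s) :=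
        hp.continuousWithinAt.comp continuousWithinAt_snd fun q hq ↦ hq.2
      have h1 : ContinuousWithinAt (fun q : ℝ × ℝ ↦ (q.1, q.2, p q.2))
          ((J ×ˢ J) ∩ (fun q : ℝ × ℝ ↦ p q.2) ⁻¹' B) (s, s) :=
        (continuousWithinAt_fst.prodMk (continuousWithinAt_snd.prodMk hpc)).mono inter_subset_left
      have h2 : ContinuousWithinAt (fun q : ℝ × ℝ ↦ Φ q.1 q.2 (p q.2))
          ((J ×ˢ J) ∩ (fun q : ℝ × ℝ ↦ p q.2) ⁻¹' B) (s, s) :=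
        ContinuousWithinAt.comp (g := fun q : ℝ × ℝ × E ↦ Φ q.1 q.2.1 q.2.2)
          (f := fun q : ℝ × ℝ ↦ (q.1, q.2, p q.2)) (x := (s, s))
          (h.continuousOn (s, s, p s) ⟨hs, hs, hpB⟩) h1 fun q hq ↦ ⟨hq.1.1, hq.1.2, hq.2⟩
      have h3 : ContinuousWithinAt (fun q : ℝ × ℝ ↦ f q.1 (Φ q.1 q.2 (p q.2)))
          ((J ×ˢ J) ∩ (fun q : ℝ × ℝ ↦ p q.2) ⁻¹' B) (s, s) :=
        ContinuousWithinAt.comp (g := Function.uncurry f) (x := (s, s))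
          (f := fun q : ℝ × ℝ ↦ (q.1, Φ q.1 q.2 (p q.2)))
          (hf (s, Φ s s (p s)) ⟨hs, h.mem s hs s hs _ hpB⟩) (continuousWithinAt_fst.prodMk h2)
          fun q hq ↦ ⟨hq.1.1, h.mem _ hq.1.1 _ hq.1.2 _ hq.2⟩
      exact h3.mono_of_mem_nhdsWithin
        (inter_mem self_mem_nhdsWithin (hpc (hB.mem_nhds hpB)))
    have h4 : ∀ᶠ q in 𝓝[J ×ˢ J] (s, s), ‖f q.1 (Φ q.1 q.2 (p q.2)) - f s (p s)‖ ≤ ε := by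
      have := hcont (closedBall_mem_nhds _ hε)
      filter_upwards [this] with q hq
      simpa [dist_eq_norm, h.apply_self s hs _ hpB] using hq
    obtain ⟨η, hη, hηJ⟩ := Metric.mem_nhdsWithin_iff.1 h4
    filter_upwards [hevB, self_mem_nhdsWithin, mem_nhdsWithin_of_mem_nhds (ball_mem_nhds s hη)]
      with τ hτB hτ hτη
    have hsub : uIcc τ s ⊆ J ∩ ball s η := fun x hx ↦
      ⟨hJ.uIcc_subset hτ hs hx,
        (convex_ball s η).ordConnected.uIcc_subset hτη (mem_ball_self hη) hx⟩
    have hmv := (convex_uIcc τ s).norm_image_sub_le_of_norm_hasDerivWithin_le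
      (f := fun x ↦ Φ x τ (p τ) - x • f s (p s))
      (f' := fun x ↦ f x (Φ x τ (p τ)) - (1 : ℝ) • f s (p s)) (C := ε) (x := τ) (y := s)
      (fun x hx ↦ ((h.hasDerivAt x (hsub hx).1 τ hτ _ hτB).sub
        ((hasDerivAt_id x).smul_const _)).hasDerivWithinAt)
      (fun x hx ↦ by
        rw [one_smul]
        refine hηJ (a := (x, τ)) ⟨?_, (hsub hx).1, hτ⟩
        rw [mem_ball, Prod.dist_eq]
        exact max_lt (hsub hx).2 hτη) left_mem_uIcc right_mem_uIcc
    rw [h.apply_self τ hτ _ hτB] at hmv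
    rw [h.apply_self s hs _ hpB, sub_self, sub_zero, norm_sub_rev τ s]
    convert hmv using 2
    module
  have h5 : HasDerivWithinAt (fun τ ↦ Φ s τ (p τ)) (p' - f s (p s)) J s := by
    have := hdisp.add hp
    rw [neg_add_eq_sub] at this
    refine this.congr_of_eventuallyEq (.of_forall fun τ ↦ ?_) ?_ <;> simp
  have h6 : Φ s s (p s) = p s := h.apply_self s hs _ hpB
  have hevB' : ∀ᶠ τ in 𝓝[J] s, Φ s τ (p τ) ∈ B :=
    h5.continuousWithinAt (hB.mem_nhds (by rwa [h6]))
  have h7 : HasFDerivAt (Φ r s) (V r s (p s)) (Φ s s (p s)) := by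
    rw [h6]; exact h.hasFDerivAt r hr s hs _ hpB
  refine (h7.comp_hasDerivWithinAt s h5).congr_of_eventuallyEq ?_ ?_
  · filter_upwards [hevB, hevB', self_mem_nhdsWithin] with τ h1 h2 hτ
    exact (h.comp r hr s hs τ hτ _ h1 h2).symm
  · simp [h6]

/-- The curve of `hasDerivWithinAt_comp` is `C^1` if `p` is. -/
theorem contDiffOn_comp (h : IsLocalFlow J B U f Φ V) (hJ : J.OrdConnected) (hB : IsOpen B)
    (hf : ContinuousOn (Function.uncurry f) (J ×ˢ U)) {p : ℝ → E} {r : ℝ} (hr : r ∈ J) {S : Set ℝ}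
    (hSJ : S ⊆ J) (hS : UniqueDiffOn ℝ S) (hJS : ∀ s ∈ S, S ∈ 𝓝[J] s) (hpB : MapsTo p S B)
    (hBU : B ⊆ U) (hp : ContDiffOn ℝ 1 p S) :
    ContDiffOn ℝ 1 (fun τ ↦ Φ r τ (p τ)) S := by
  have hder (s : ℝ) (hs : s ∈ S) : HasDerivWithinAt (fun τ ↦ Φ r τ (p τ))
      (V r s (p s) (derivWithin p S s - f s (p s))) S s := by
    refine (h.hasDerivWithinAt_comp hJ hB hf hr (hSJ hs) (hpB hs) ?_).mono hSJ
    exact ((hp s hs).differentiableWithinAt one_ne_zero).hasDerivWithinAt.mono_of_mem_nhdsWithin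
      (hJS s hs)
  rw [contDiffOn_one_iff_derivWithin hS] at hp ⊢
  refine ⟨fun s hs ↦ (hder s hs).differentiableWithinAt, ?_⟩
  have hpc : ContinuousOn p S := hp.1.continuousOn
  have h1 : ContinuousOn (fun s ↦ V r s (p s)) S :=
    h.continuousOn_deriv.comp (f := fun s ↦ (r, s, p s)) (by fun_prop)
      fun s hs ↦ ⟨hr, hSJ hs, hpB hs⟩
  have h2 : ContinuousOn (fun s ↦ f s (p s)) S :=
    hf.comp (f := fun s ↦ (s, p s)) (by fun_prop) fun s hs ↦ ⟨hSJ hs, hBU (hpB hs)⟩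
  exact (h1.clm_apply (hp.2.sub h2)).congr fun s hs ↦ (hder s hs).derivWithin (hS s hs)

end IsLocalFlow

/-! ### Curves and vector fields in a chart -/

section ChartRepresentation

variable {E : Type*} [NormedAddCommGroup E] [NormedSpace ℝ E]
  {M : Type*} [TopologicalSpace M] [ChartedSpace E M]

theorem extChartAt_symm_mem_chartAt_source {x₀ : M} {y : E}
    (hy : y ∈ (extChartAt 𝓘(ℝ, E) x₀).target) :
    (extChartAt 𝓘(ℝ, E) x₀).symm y ∈ (chartAt E x₀).source := by
  rw [← extChartAt_source 𝓘(ℝ, E)]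
  exact (extChartAt 𝓘(ℝ, E) x₀).map_target hy

theorem source_inter_preimage_ball_mem_nhds {x₀ x : M} {c : E} {ρ : ℝ}
    (hx : x ∈ (chartAt E x₀).source) (hxB : extChartAt 𝓘(ℝ, E) x₀ x ∈ Metric.ball c ρ) :
    (chartAt E x₀).source ∩ extChartAt 𝓘(ℝ, E) x₀ ⁻¹' Metric.ball c ρ ∈ nhds x :=
  Filter.inter_mem ((chartAt E x₀).open_source.mem_nhds hx)
    ((continuousAt_extChartAt' (by rwa [extChartAt_source])).preimage_mem_nhds
      (Metric.isOpen_ball.mem_nhds hxB))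

variable [IsManifold 𝓘(ℝ, E) ∞ M]

/-- The coordinate expression of a smooth time-dependent vector field is jointly smooth in time and
space, up to the endpoints of the time interval. -/
theorem contDiffOn_chartField {J : Set ℝ} {X : ℝ → (m : M) → TangentSpace 𝓘(ℝ, E) m}
    (hX : SmoothTimeDepField J X) (x₀ : M) :
    ContDiffOn ℝ ∞ (Function.uncurry fun r y ↦ chartField x₀ (X r) y)
      (J ×ˢ (extChartAt 𝓘(ℝ, E) x₀).target) := by
  have h1 : ContMDiffOn (𝓘(ℝ, ℝ).prod 𝓘(ℝ, E)) (𝓘(ℝ, ℝ).prod 𝓘(ℝ, E)) ∞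
      (fun p : ℝ × E ↦ (p.1, (extChartAt 𝓘(ℝ, E) x₀).symm p.2))
      (J ×ˢ (extChartAt 𝓘(ℝ, E) x₀).target) :=
    contMDiffOn_fst.prodMk ((contMDiffOn_extChartAt_symm x₀).comp contMDiffOn_snd fun p hp ↦ hp.2)
  have h2 := ContMDiffOn.comp (E' := ℝ × E) (M' := ℝ × M) hX h1 fun p hp ↦ ⟨hp.1, mem_univ _⟩
  have hmaps : MapsTo ((fun p : ℝ × M ↦ (⟨p.2, X p.1 p.2⟩ : TangentBundle 𝓘(ℝ, E) M)) ∘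
      fun p : ℝ × E ↦ (p.1, (extChartAt 𝓘(ℝ, E) x₀).symm p.2))
      (J ×ˢ (extChartAt 𝓘(ℝ, E) x₀).target)
      (trivializationAt E (TangentSpace 𝓘(ℝ, E)) x₀).source := fun p hp ↦ by
    rw [Trivialization.mem_source]
    exact extChartAt_symm_mem_chartAt_source hp.2
  have h3 := ((Trivialization.contMDiffOn_iff hmaps).1 h2).2
  rw [← modelWithCornersSelf_prod, chartedSpaceSelf_prod] at h3
  refine h3.contDiffOn.congr ?_
  rintro ⟨r, y⟩ ⟨-, hy⟩
  have hb : (extChartAt 𝓘(ℝ, E) x₀).symm y ∈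
      (trivializationAt E (TangentSpace 𝓘(ℝ, E)) x₀).baseSet :=
    extChartAt_symm_mem_chartAt_source hy
  simp only [Function.uncurry, chartField, Function.comp]
  rw [Trivialization.continuousLinearMapAt_apply, Trivialization.coe_linearMapAt_of_mem _ hb]

theorem hasMFDerivAt_extChartAt_symm {x₀ : M} {y : E}
    (hy : y ∈ (extChartAt 𝓘(ℝ, E) x₀).target) :
    HasMFDerivAt 𝓘(ℝ, E) 𝓘(ℝ, E) (extChartAt 𝓘(ℝ, E) x₀).symm y
      ((trivializationAt E (TangentSpace 𝓘(ℝ, E)) x₀).symmL ℝ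
        ((extChartAt 𝓘(ℝ, E) x₀).symm y)) := by
  have h1 := (mdifferentiableWithinAt_extChartAt_symm (I := 𝓘(ℝ, E)) hy).hasMFDerivWithinAt
  rw [TangentBundle.symmL_trivializationAt (extChartAt_symm_mem_chartAt_source hy),
    (extChartAt 𝓘(ℝ, E) x₀).right_inv hy]
  rw [← hasMFDerivWithinAt_univ]
  simpa using! h1

theorem hasMFDerivAt_extChartAt' {x₀ x : M} (hx : x ∈ (chartAt E x₀).source) :
    HasMFDerivAt 𝓘(ℝ, E) 𝓘(ℝ, E) (extChartAt 𝓘(ℝ, E) x₀) x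
      ((trivializationAt E (TangentSpace 𝓘(ℝ, E)) x₀).continuousLinearMapAt ℝ x) := by
  rw [TangentBundle.continuousLinearMapAt_trivializationAt hx]
  exact (mdifferentiableAt_extChartAt hx).hasMFDerivAt

theorem hasDerivWithinAt_extChartAt_comp {J : Set ℝ} {γ : ℝ → M} {x₀ : M} {r : ℝ}
    (hr : γ r ∈ (chartAt E x₀).source) {v : TangentSpace 𝓘(ℝ, E) (γ r)}
    (hγ : HasMFDerivWithinAt 𝓘(ℝ, ℝ) 𝓘(ℝ, E) γ J r ((1 : ℝ →L[ℝ] ℝ).smulRight v)) :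
    HasDerivWithinAt (fun τ ↦ extChartAt 𝓘(ℝ, E) x₀ (γ τ))
      ((trivializationAt E (TangentSpace 𝓘(ℝ, E)) x₀).continuousLinearMapAt ℝ (γ r) v) J r := by
  have h1 := (hasMFDerivAt_extChartAt' hr).comp_hasMFDerivWithinAt r hγ
  have h2 : HasFDerivWithinAt (fun τ ↦ extChartAt 𝓘(ℝ, E) x₀ (γ τ))
      ((1 : ℝ →L[ℝ] ℝ).smulRight (show E from
        (trivializationAt E (TangentSpace 𝓘(ℝ, E)) x₀).continuousLinearMapAt ℝ (γ r) v)) J r := by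
    refine (hasMFDerivWithinAt_iff_hasFDerivWithinAt.1 h1).congr_fderiv ?_
    exact ContinuousLinearMap.ext fun (c : ℝ) ↦ map_smul
      ((trivializationAt E (TangentSpace 𝓘(ℝ, E)) x₀).continuousLinearMapAt ℝ (γ r))
        (show ℝ from c) v
  simpa using h2.hasDerivWithinAt

theorem hasMFDerivWithinAt_extChartAt_symm_comp {J : Set ℝ} {η : ℝ → E} {x₀ : M} {r : ℝ}
    (hr : η r ∈ (extChartAt 𝓘(ℝ, E) x₀).target) {v : E} (hη : HasDerivWithinAt η v J r) :
    HasMFDerivWithinAt 𝓘(ℝ, ℝ) 𝓘(ℝ, E) (fun τ ↦ (extChartAt 𝓘(ℝ, E) x₀).symm (η τ)) J r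
      ((1 : ℝ →L[ℝ] ℝ).smulRight ((trivializationAt E (TangentSpace 𝓘(ℝ, E)) x₀).symmL ℝ
        ((extChartAt 𝓘(ℝ, E) x₀).symm (η r)) v)) := by
  have h1 := (hasMFDerivAt_extChartAt_symm hr).comp_hasMFDerivWithinAt r
    (hasMFDerivWithinAt_iff_hasFDerivWithinAt.2 hη.hasFDerivWithinAt)
  refine h1.congr_mfderiv ?_
  exact ContinuousLinearMap.ext fun (c : ℝ) ↦ map_smul ((trivializationAt E (TangentSpace 𝓘(ℝ, E))
    x₀).symmL ℝ ((extChartAt 𝓘(ℝ, E) x₀).symm (η r))) (show ℝ from c) v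

end ChartRepresentation

/-! ### The flow on the manifold -/

open Metric Filter Topology in
theorem exists_lipschitzOnWith_of_contDiffOn_uncurry {E : Type*} [NormedAddCommGroup E]
    [NormedSpace ℝ E] {J : Set ℝ} (hJ : Convex ℝ J) {U : Set E} (hU : IsOpen U) {f : ℝ → E → E}
    (hf : ContDiffOn ℝ ∞ (Function.uncurry f) (J ×ˢ U)) {s₀ : ℝ} (hs₀ : s₀ ∈ J) {y₀ : E}
    (hy₀ : y₀ ∈ U) :
    ∃ K : NNReal, ∃ δ > 0, ∃ ρ > 0, ∀ τ ∈ J ∩ ball s₀ δ, LipschitzOnWith K (f τ) (ball y₀ ρ) := by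
  obtain ⟨r₀, hr₀, hr₀U⟩ := Metric.isOpen_iff.1 hU y₀ hy₀
  have h1 : ContDiffOn ℝ 1 (Function.uncurry f) (J ×ˢ ball y₀ r₀) :=
    (hf.of_le (by norm_cast)).mono (prod_mono le_rfl hr₀U)
  obtain ⟨K, S, hS, hKS⟩ := (h1 (s₀, y₀) ⟨hs₀, mem_ball_self hr₀⟩).exists_lipschitzOnWith
    (hJ.prod (convex_ball _ _))
  obtain ⟨ρ₀, hρ₀, hρ₀S⟩ := Metric.mem_nhdsWithin_iff.1 hS
  refine ⟨K, ρ₀, hρ₀, min ρ₀ r₀, by positivity, fun τ hτ ↦ ?_⟩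
  have hmem {y : E} (hy : y ∈ ball y₀ (min ρ₀ r₀)) : (τ, y) ∈ S := by
    refine hρ₀S ⟨?_, hτ.1, ball_subset_ball (min_le_right _ _) hy⟩
    rw [mem_ball, Prod.dist_eq]
    exact max_lt hτ.2 ((mem_ball.1 hy).trans_le (min_le_left _ _))
  refine LipschitzOnWith.of_dist_le_mul fun y hy y' hy' ↦ ?_
  simpa [Prod.dist_eq, Function.uncurry] using hKS.dist_le_mul _ (hmem hy) _ (hmem hy')

section Flow

open Filter Topology

variable {E : Type*} [NormedAddCommGroup E] [NormedSpace ℝ E]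
  {M : Type*} [TopologicalSpace M] [ChartedSpace E M]
  {a b : ℝ} {X : ℝ → (m : M) → TangentSpace 𝓘(ℝ, E) m}

theorem isSolutionOn_timeDepFlow {J : Set ℝ} (hXc : CompleteTimeDepField J X) {s : ℝ}
    (hs : s ∈ J) (m : M) : IsSolutionOn J X (fun r ↦ timeDepFlow J X r s m) := by
  have h := hXc s hs m
  simpa only [timeDepFlow, dif_pos h] using h.choose_spec.1

theorem timeDepFlow_self {J : Set ℝ} (hXc : CompleteTimeDepField J X) {s : ℝ}
    (hs : s ∈ J) (m : M) : timeDepFlow J X s s m = m := by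
  have h := hXc s hs m
  simpa only [timeDepFlow, dif_pos h] using h.choose_spec.2

theorem continuousOn_timeDepFlow {J : Set ℝ} (hXc : CompleteTimeDepField J X) {s : ℝ}
    (hs : s ∈ J) (m : M) : ContinuousOn (fun r ↦ timeDepFlow J X r s m) J :=
  fun r hr ↦ (isSolutionOn_timeDepFlow hXc hs m r hr).continuousWithinAt

variable [IsManifold 𝓘(ℝ, E) ∞ M]

/-- Local uniqueness of solutions, by Grönwall's inequality in a chart. -/
theorem eventuallyEq_of_hasMFDerivWithinAt (hX : SmoothTimeDepField (Icc a b) X) {γ₁ γ₂ : ℝ → M}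
    {r₀ : ℝ} (hr₀ : r₀ ∈ Icc a b)
    (h₁ : ∀ᶠ r in 𝓝[Icc a b] r₀, HasMFDerivWithinAt 𝓘(ℝ, ℝ) 𝓘(ℝ, E) γ₁ (Icc a b) r
      ((1 : ℝ →L[ℝ] ℝ).smulRight (X r (γ₁ r))))
    (h₂ : ∀ᶠ r in 𝓝[Icc a b] r₀, HasMFDerivWithinAt 𝓘(ℝ, ℝ) 𝓘(ℝ, E) γ₂ (Icc a b) r
      ((1 : ℝ →L[ℝ] ℝ).smulRight (X r (γ₂ r))))
    (h₀ : γ₁ r₀ = γ₂ r₀) : γ₁ =ᶠ[𝓝[Icc a b] r₀] γ₂ := by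
  set x₀ := γ₁ r₀ with hx₀
  set e := extChartAt 𝓘(ℝ, E) x₀ with he
  have hf := contDiffOn_chartField hX x₀
  obtain ⟨K, δ, hδ, ρ, hρ, hK⟩ := exists_lipschitzOnWith_of_contDiffOn_uncurry (convex_Icc a b)
    (isOpen_extChartAt_target x₀) hf hr₀ (mem_extChartAt_target x₀)
  have hnhds : (chartAt E x₀).source ∩ e ⁻¹' Metric.ball (e x₀) ρ ∈ 𝓝 x₀ :=
    inter_mem (chart_source_mem_nhds E x₀)
      ((continuousAt_extChartAt x₀).preimage_mem_nhds (Metric.ball_mem_nhds _ hρ))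
  have hc₁ := (h₁.self_of_nhdsWithin hr₀).continuousWithinAt hnhds
  have hc₂ := (h₂.self_of_nhdsWithin hr₀).continuousWithinAt (by rw [← h₀]; exact hnhds)
  obtain ⟨η, hη, hηJ⟩ := Metric.mem_nhdsWithin_iff.1 (inter_mem (inter_mem h₁ h₂)
    (inter_mem (inter_mem hc₁ hc₂) (mem_nhdsWithin_of_mem_nhds (Metric.ball_mem_nhds r₀ hδ))))
  filter_upwards [self_mem_nhdsWithin, mem_nhdsWithin_of_mem_nhds (Metric.ball_mem_nhds r₀ hη)]
    with r hr hrη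
  have hmem {x : ℝ} (hx : x ∈ Icc a b ∩ Metric.ball r₀ η) := hηJ ⟨hx.2, hx.1⟩
  have hd {γ : ℝ → M} {x : ℝ} (h : HasMFDerivWithinAt 𝓘(ℝ, ℝ) 𝓘(ℝ, E) γ (Icc a b) x
      ((1 : ℝ →L[ℝ] ℝ).smulRight (X x (γ x)))) (hs : γ x ∈ (chartAt E x₀).source) :
      HasDerivWithinAt (fun τ ↦ e (γ τ)) (chartField x₀ (X x) (e (γ x)))
        (Icc a b ∩ Metric.ball r₀ η) x := by
    have h3 := (hasDerivWithinAt_extChartAt_comp hs h).mono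
      (inter_subset_left (t := Metric.ball r₀ η))
    rwa [chartField, he, (extChartAt 𝓘(ℝ, E) x₀).left_inv (by rwa [extChartAt_source])]
  have hgr := norm_le_gronwallBound_abs_sub (f := fun τ ↦ e (γ₁ τ) - e (γ₂ τ))
    (f' := fun τ ↦ chartField x₀ (X τ) (e (γ₁ τ)) - chartField x₀ (X τ) (e (γ₂ τ))) (K := K)
    (ε := 0) (ordConnected_Icc.inter (convex_ball r₀ η).ordConnected)
    (fun x hx ↦ (hd (hmem hx).1.1 (hmem hx).2.1.1.1).sub (hd (hmem hx).1.2 (hmem hx).2.1.2.1))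
    (fun x hx ↦ by
      simpa using (hK x ⟨hx.1, (hmem hx).2.2⟩).norm_sub_le (hmem hx).2.1.1.2 (hmem hx).2.1.2.2)
    ⟨hr₀, Metric.mem_ball_self hη⟩ ⟨hr, hrη⟩
  rw [← h₀, sub_self, norm_zero, gronwallBound_ε0_δ0] at hgr
  have hr' := (hmem ⟨hr, hrη⟩).2.1
  exact e.injOn (by rw [he, extChartAt_source]; exact hr'.1.1)
    (by rw [he, extChartAt_source]; exact hr'.2.1) (sub_eq_zero.1 (norm_le_zero_iff.1 hgr))

/-- Uniqueness of solutions on a relatively open interval of `[a, b]`. The times at which two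
solutions agree form a relatively open set by local uniqueness, and so do the times at which they
differ, as `M` is Hausdorff. -/
theorem eqOn_of_hasMFDerivWithinAt [T2Space M] (hX : SmoothTimeDepField (Icc a b) X)
    {γ₁ γ₂ : ℝ → M} {S : Set ℝ} (hS : IsPreconnected S) (hSJ : S ⊆ Icc a b)
    (hSn : ∀ r ∈ S, S ∈ 𝓝[Icc a b] r)
    (h₁ : ∀ r ∈ S, HasMFDerivWithinAt 𝓘(ℝ, ℝ) 𝓘(ℝ, E) γ₁ (Icc a b) r
      ((1 : ℝ →L[ℝ] ℝ).smulRight (X r (γ₁ r))))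
    (h₂ : ∀ r ∈ S, HasMFDerivWithinAt 𝓘(ℝ, ℝ) 𝓘(ℝ, E) γ₂ (Icc a b) r
      ((1 : ℝ →L[ℝ] ℝ).smulRight (X r (γ₂ r))))
    {s : ℝ} (hs : s ∈ S) (h₀ : γ₁ s = γ₂ s) : EqOn γ₁ γ₂ S := by
  intro r hr
  refine hS.induction₂' (fun x y ↦ γ₁ x = γ₂ x → γ₁ y = γ₂ y) (fun x hx ↦ ?_)
    (fun x y z _ _ _ hxy hyz h ↦ hyz (hxy h)) hs hr h₀
  refine Eventually.filter_mono (nhdsWithin_mono x hSJ) ?_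
  by_cases h : γ₁ x = γ₂ x
  · filter_upwards [eventuallyEq_of_hasMFDerivWithinAt hX (hSJ hx)
      (eventually_of_mem (hSn x hx) h₁) (eventually_of_mem (hSn x hx) h₂) h] with y hy
    exact ⟨fun _ ↦ hy, fun _ ↦ h⟩
  · have hne : ∀ᶠ y in 𝓝[Icc a b] x, γ₁ y ≠ γ₂ y :=
      ((h₁ x hx).continuousWithinAt.prodMk (h₂ x hx).continuousWithinAt)
        (isClosed_diagonal.isOpen_compl.mem_nhds h)
    filter_upwards [hne] with y hy
    exact ⟨fun h' ↦ absurd h' h, fun h' ↦ absurd h' hy⟩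

variable [T2Space M]

theorem eqOn_timeDepFlow (hX : SmoothTimeDepField (Icc a b) X)
    (hXc : CompleteTimeDepField (Icc a b) X) {γ : ℝ → M} {S : Set ℝ} (hS : IsPreconnected S)
    (hSJ : S ⊆ Icc a b) (hSn : ∀ r ∈ S, S ∈ 𝓝[Icc a b] r)
    (hγ : ∀ r ∈ S, HasMFDerivWithinAt 𝓘(ℝ, ℝ) 𝓘(ℝ, E) γ (Icc a b) r
      ((1 : ℝ →L[ℝ] ℝ).smulRight (X r (γ r)))) {s : ℝ} (hs : s ∈ S) :
    EqOn (fun r ↦ timeDepFlow (Icc a b) X r s (γ s)) γ S :=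
  eqOn_of_hasMFDerivWithinAt hX hS hSJ hSn
    (fun r hr ↦ isSolutionOn_timeDepFlow hXc (hSJ hs) _ r (hSJ hr)) hγ hs
    (timeDepFlow_self hXc (hSJ hs) _)

theorem timeDepFlow_comp (hX : SmoothTimeDepField (Icc a b) X)
    (hXc : CompleteTimeDepField (Icc a b) X) {r s' s : ℝ} (hr : r ∈ Icc a b)
    (hs' : s' ∈ Icc a b) (hs : s ∈ Icc a b) (m : M) :
    timeDepFlow (Icc a b) X r s' (timeDepFlow (Icc a b) X s' s m) =
      timeDepFlow (Icc a b) X r s m :=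
  eqOn_timeDepFlow hX hXc isPreconnected_Icc subset_rfl (fun _ _ ↦ self_mem_nhdsWithin)
    (isSolutionOn_timeDepFlow hXc hs m) hs' hr

end Flow

section LocalFlow

open Filter Topology Metric

variable {E : Type*} [NormedAddCommGroup E] [NormedSpace ℝ E]
  {M : Type*} [TopologicalSpace M] [ChartedSpace E M] [IsManifold 𝓘(ℝ, E) ∞ M]
  {a b : ℝ} {X : ℝ → (m : M) → TangentSpace 𝓘(ℝ, E) m} {x₀ : M} {s₀ δ ρ : ℝ}
  {Φ : ℝ → ℝ → E → E} {V : ℝ → ℝ → E → E →L[ℝ] E}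

/-- `Φ`, with derivative `V`, is the flow of the time-dependent vector field `X` in the preferred
chart at `x₀`, for times in `[a, b]` at distance less than `δ` of `s₀` and for initial points in the
ball of radius `ρ` around the coordinates of `x₀`. -/
structure IsChartFlow (a b : ℝ) (X : ℝ → (m : M) → TangentSpace 𝓘(ℝ, E) m) (x₀ : M) (s₀ δ ρ : ℝ)
    (Φ : ℝ → ℝ → E → E) (V : ℝ → ℝ → E → E →L[ℝ] E) : Prop where
  time_pos : 0 < δ
  radius_pos : 0 < ρ
  ball_subset : ball (extChartAt 𝓘(ℝ, E) x₀ x₀) ρ ⊆ (extChartAt 𝓘(ℝ, E) x₀).target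
  isLocalFlow : IsLocalFlow (Icc a b ∩ ball s₀ δ) (ball (extChartAt 𝓘(ℝ, E) x₀ x₀) ρ)
    (extChartAt 𝓘(ℝ, E) x₀).target (fun r y ↦ chartField x₀ (X r) y) Φ V
  timeDepFlow_eq : ∀ r ∈ Icc a b ∩ ball s₀ δ, ∀ s ∈ Icc a b ∩ ball s₀ δ,
    ∀ x ∈ (chartAt E x₀).source, extChartAt 𝓘(ℝ, E) x₀ x ∈ ball (extChartAt 𝓘(ℝ, E) x₀ x₀) ρ →
      timeDepFlow (Icc a b) X r s x =
        (extChartAt 𝓘(ℝ, E) x₀).symm (Φ r s (extChartAt 𝓘(ℝ, E) x₀ x))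

theorem exists_isChartFlow [FiniteDimensional ℝ E] [T2Space M] (hab : a < b)
    (hX : SmoothTimeDepField (Icc a b) X) (hXc : CompleteTimeDepField (Icc a b) X)
    (hs₀ : s₀ ∈ Icc a b) (x₀ : M) : ∃ δ ρ Φ V, IsChartFlow a b X x₀ s₀ δ ρ Φ V := by
  obtain ⟨δ, hδ, ρ, hρ, Φ, V, hsub, h⟩ := exists_isLocalFlow hab hs₀
    (isOpen_extChartAt_target x₀) (mem_extChartAt_target x₀) (contDiffOn_chartField hX x₀)
  refine ⟨δ, ρ, Φ, V, hδ, hρ, hsub, h, fun r hr s hs x hx hxB ↦ ?_⟩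
  have h1 := eqOn_timeDepFlow hX hXc (S := Icc a b ∩ ball s₀ δ)
    (γ := fun τ ↦ (extChartAt 𝓘(ℝ, E) x₀).symm (Φ τ s (extChartAt 𝓘(ℝ, E) x₀ x)))
    ((convex_Icc a b).inter (convex_ball s₀ δ)).isPreconnected inter_subset_left
    (fun τ hτ ↦ inter_mem self_mem_nhdsWithin
      (mem_nhdsWithin_of_mem_nhds (isOpen_ball.mem_nhds hτ.2)))
    (fun τ hτ ↦ by
      have hm := h.mem τ hτ s hs _ hxB
      have h2 := hasMFDerivWithinAt_extChartAt_symm_comp hm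
        (h.hasDerivAt τ hτ s hs _ hxB).hasDerivWithinAt (J := Icc a b)
      rwa [chartField, Trivialization.symmL_continuousLinearMapAt] at h2
      exact extChartAt_symm_mem_chartAt_source hm) hs hr
  simp only [h.apply_self s hs _ hxB] at h1
  rwa [(extChartAt 𝓘(ℝ, E) x₀).left_inv (by rwa [extChartAt_source])] at h1

namespace IsChartFlow

theorem mem_nhds_self (h : IsChartFlow a b X x₀ s₀ δ ρ Φ V) : (chartAt E x₀).source ∩
    extChartAt 𝓘(ℝ, E) x₀ ⁻¹' ball (extChartAt 𝓘(ℝ, E) x₀ x₀) ρ ∈ 𝓝 x₀ :=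
  source_inter_preimage_ball_mem_nhds (mem_chart_source E x₀) (mem_ball_self h.radius_pos)

theorem eventuallyEq (h : IsChartFlow a b X x₀ s₀ δ ρ Φ V) {r s : ℝ}
    (hr : r ∈ Icc a b ∩ ball s₀ δ) (hs : s ∈ Icc a b ∩ ball s₀ δ) {x : M}
    (hx : x ∈ (chartAt E x₀).source)
    (hxB : extChartAt 𝓘(ℝ, E) x₀ x ∈ ball (extChartAt 𝓘(ℝ, E) x₀ x₀) ρ) :
    timeDepFlow (Icc a b) X r s =ᶠ[𝓝 x]
      fun x ↦ (extChartAt 𝓘(ℝ, E) x₀).symm (Φ r s (extChartAt 𝓘(ℝ, E) x₀ x)) := by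
  filter_upwards [source_inter_preimage_ball_mem_nhds hx hxB] with x' hx'
  exact h.timeDepFlow_eq r hr s hs x' hx'.1 hx'.2

theorem contMDiffAt (h : IsChartFlow a b X x₀ s₀ δ ρ Φ V) {r s : ℝ}
    (hr : r ∈ Icc a b ∩ ball s₀ δ) (hs : s ∈ Icc a b ∩ ball s₀ δ) {x : M}
    (hx : x ∈ (chartAt E x₀).source)
    (hxB : extChartAt 𝓘(ℝ, E) x₀ x ∈ ball (extChartAt 𝓘(ℝ, E) x₀ x₀) ρ) :
    ContMDiffAt 𝓘(ℝ, E) 𝓘(ℝ, E) 1 (timeDepFlow (Icc a b) X r s) x := by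
  refine ContMDiffAt.congr_of_eventuallyEq ?_ (h.eventuallyEq hr hs hx hxB)
  have h1 : ContMDiffAt 𝓘(ℝ, E) 𝓘(ℝ, E) 1 (extChartAt 𝓘(ℝ, E) x₀) x := contMDiffAt_extChartAt' hx
  have h2 : ContMDiffAt 𝓘(ℝ, E) 𝓘(ℝ, E) 1 (Φ r s) (extChartAt 𝓘(ℝ, E) x₀ x) :=
    ((h.isLocalFlow.contDiffOn isOpen_ball hr hs).contDiffAt
      (isOpen_ball.mem_nhds hxB)).contMDiffAt
  have h3 : ContMDiffAt 𝓘(ℝ, E) 𝓘(ℝ, E) 1 (extChartAt 𝓘(ℝ, E) x₀).symm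
      (Φ r s (extChartAt 𝓘(ℝ, E) x₀ x)) :=
    (contMDiffOn_extChartAt_symm x₀).contMDiffAt
      ((isOpen_extChartAt_target x₀).mem_nhds (h.isLocalFlow.mem r hr s hs _ hxB))
  exact h3.comp x (h2.comp x h1)

theorem hasMFDerivAt (h : IsChartFlow a b X x₀ s₀ δ ρ Φ V) {r s : ℝ}
    (hr : r ∈ Icc a b ∩ ball s₀ δ) (hs : s ∈ Icc a b ∩ ball s₀ δ) {x : M}
    (hx : x ∈ (chartAt E x₀).source)
    (hxB : extChartAt 𝓘(ℝ, E) x₀ x ∈ ball (extChartAt 𝓘(ℝ, E) x₀ x₀) ρ) :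
    HasMFDerivAt 𝓘(ℝ, E) 𝓘(ℝ, E)
      (fun x ↦ (extChartAt 𝓘(ℝ, E) x₀).symm (Φ r s (extChartAt 𝓘(ℝ, E) x₀ x))) x
      (((trivializationAt E (TangentSpace 𝓘(ℝ, E)) x₀).symmL ℝ
        ((extChartAt 𝓘(ℝ, E) x₀).symm (Φ r s (extChartAt 𝓘(ℝ, E) x₀ x)))).comp
        ((V r s (extChartAt 𝓘(ℝ, E) x₀ x)).comp
          ((trivializationAt E (TangentSpace 𝓘(ℝ, E)) x₀).continuousLinearMapAt ℝ x))) :=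
  (hasMFDerivAt_extChartAt_symm (h.isLocalFlow.mem r hr s hs _ hxB)).comp x
    ((h.isLocalFlow.hasFDerivAt r hr s hs _ hxB).hasMFDerivAt.comp x (hasMFDerivAt_extChartAt' hx))

end IsChartFlow

/-- The flow of a smooth complete time-dependent vector field is `C^1` in the initial point. Along
a trajectory, the times between which this holds form an equivalence relation with open classes. -/
theorem contMDiff_timeDepFlow [FiniteDimensional ℝ E] [T2Space M] (hab : a < b)
    (hX : SmoothTimeDepField (Icc a b) X) (hXc : CompleteTimeDepField (Icc a b) X) {r s : ℝ}
    (hr : r ∈ Icc a b) (hs : s ∈ Icc a b) :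
    ContMDiff 𝓘(ℝ, E) 𝓘(ℝ, E) 1 (timeDepFlow (Icc a b) X r s) := by
  intro x
  set γ : ℝ → M := fun τ ↦ timeDepFlow (Icc a b) X τ s x with hγ
  have key := (isPreconnected_Icc (a := a) (b := b)).induction₂' (fun τ τ' ↦
    ContMDiffAt 𝓘(ℝ, E) 𝓘(ℝ, E) 1 (timeDepFlow (Icc a b) X τ' τ) (γ τ)) (fun τ hτ ↦ ?_)
    (fun τ τ' τ'' hτ hτ' hτ'' h1 h2 ↦ ?_) hs hr
  · simpa [hγ, timeDepFlow_self hXc hs] using key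
  · obtain ⟨δ, ρ, Φ, V, h⟩ := exists_isChartFlow hab hX hXc hτ (γ τ)
    have h3 : ∀ᶠ τ' in 𝓝[Icc a b] τ, γ τ' ∈ (chartAt E (γ τ)).source ∩
        extChartAt 𝓘(ℝ, E) (γ τ) ⁻¹' ball (extChartAt 𝓘(ℝ, E) (γ τ) (γ τ)) ρ :=
      continuousOn_timeDepFlow hXc hs x τ hτ h.mem_nhds_self
    have hτball : τ ∈ Icc a b ∩ ball τ δ := ⟨hτ, mem_ball_self h.time_pos⟩
    filter_upwards [h3, self_mem_nhdsWithin,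
      mem_nhdsWithin_of_mem_nhds (ball_mem_nhds τ h.time_pos)] with τ' h4 h5 h6
    exact ⟨h.contMDiffAt ⟨h5, h6⟩ hτball (mem_chart_source E _) (mem_ball_self h.radius_pos),
      h.contMDiffAt hτball ⟨h5, h6⟩ h4.1 h4.2⟩
  · have h3 : timeDepFlow (Icc a b) X τ' τ (γ τ) = γ τ' := timeDepFlow_comp hX hXc hτ' hτ hs x
    have h4 : timeDepFlow (Icc a b) X τ'' τ =
        timeDepFlow (Icc a b) X τ'' τ' ∘ timeDepFlow (Icc a b) X τ' τ :=
      funext fun z ↦ (timeDepFlow_comp hX hXc hτ'' hτ' hτ z).symm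
    rw [h4]
    exact ContMDiffAt.comp (γ τ) (by rwa [h3]) h1

end LocalFlow

/-! ### A Grönwall inequality with values in `[0, ∞]` -/

section ENNExp

theorem ennExp_coe (x : NNReal) : ennExp x = ENNReal.ofReal (Real.exp x) := by
  rw [ennExp, EReal.coe_nnreal_eq_coe_real, EReal.exp_coe]

theorem ennExp_top : ennExp ⊤ = ⊤ := by
  simp [ennExp]

theorem ennExp_mono {x y : ℝ≥0∞} (h : x ≤ y) : ennExp x ≤ ennExp y :=
  EReal.exp_monotone (by exact_mod_cast h)

theorem ennExp_ofReal {x : ℝ} (hx : 0 ≤ x) :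
    ennExp (ENNReal.ofReal x) = ENNReal.ofReal (Real.exp x) := by
  rw [ENNReal.ofReal, ennExp_coe, Real.coe_toNNReal _ hx]

end ENNExp

/-- The increment of a differentiable function is at most the integral of any upper bound of the
positive part of its derivative. The bound need not be measurable, as the right derivative is. -/
theorem ofReal_sub_le_lintegral_of_hasDerivWithinAt {s t : ℝ} (hst : s ≤ t) {u u' : ℝ → ℝ}
    {N : ℝ → ℝ≥0∞} (hu : ∀ r ∈ Icc s t, HasDerivWithinAt u (u' r) (Icc s t) r)
    (hN : ∀ r ∈ Icc s t, ENNReal.ofReal (u' r) ≤ N r) :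
    ENNReal.ofReal (u t - u s) ≤ ∫⁻ r in Icc s t, N r := by
  set d : ℝ → ℝ := fun r ↦ derivWithin u (Ici r) r with hd
  have hdm : Measurable d := measurable_derivWithin_Ici u
  have hder (r : ℝ) (hr : r ∈ Ico s t) : HasDerivWithinAt u (u' r) (Ici r) r :=
    (hu r (Ico_subset_Icc_self hr)).mono_of_mem_nhdsWithin (Icc_mem_nhdsGE_of_mem hr)
  have hdeq (r : ℝ) (hr : r ∈ Ico s t) : d r = u' r :=
    (hder r hr).derivWithin (uniqueDiffWithinAt_Ici r)
  have hle : ∫⁻ r in Icc s t, ENNReal.ofReal (d r) ≤ ∫⁻ r in Icc s t, N r := by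
    rw [← restrict_Ico_eq_restrict_Icc]
    exact setLIntegral_mono' measurableSet_Ico fun r hr ↦ by
      rw [hdeq r hr]; exact hN r (Ico_subset_Icc_self hr)
  refine le_trans ?_ hle
  by_cases htop : ∫⁻ r in Icc s t, ENNReal.ofReal (d r) = ⊤
  · rw [htop]; exact le_top
  have hint : IntegrableOn (fun r ↦ max (d r) 0) (Icc s t) := by
    refine ⟨(hdm.max measurable_const).aestronglyMeasurable, ?_⟩
    rw [hasFiniteIntegral_iff_ofReal (f := fun r ↦ max (d r) 0)
      (.of_forall fun r ↦ le_max_right _ _)]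
    simpa [ENNReal.ofReal_max, lt_top_iff_ne_top] using htop
  have h1 := intervalIntegral.sub_le_integral_of_hasDeriv_right_of_le hst
    (fun r hr ↦ (hu r hr).continuousWithinAt)
    (fun r hr ↦ (hder r ⟨hr.1.le, hr.2⟩).mono Ioi_subset_Ici_self) hint
    (fun r hr ↦ by rw [← hdeq r ⟨hr.1.le, hr.2⟩]; exact le_max_left _ _)
  rw [intervalIntegral.integral_of_le hst, ← integral_Icc_eq_integral_Ioc] at h1
  calc ENNReal.ofReal (u t - u s) ≤ ENNReal.ofReal (∫ r in Icc s t, max (d r) 0) :=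
        ENNReal.ofReal_le_ofReal h1
    _ = ∫⁻ r in Icc s t, ENNReal.ofReal (max (d r) 0) :=
        ofReal_integral_eq_lintegral_ofReal hint (.of_forall fun r ↦ le_max_right _ _)
    _ = ∫⁻ r in Icc s t, ENNReal.ofReal (d r) := by simp [ENNReal.ofReal_max]

/-- Grönwall's inequality for a squared norm, with an integrated, possibly infinite, rate. As
`0 * ∞ = 0`, an initial value zero has to be treated separately if the rate is infinite, whence the
last hypothesis. -/
theorem ofReal_le_ennExp_lintegral_mul {s t : ℝ} (hst : s ≤ t) {n h' : ℝ → ℝ} {N : ℝ → ℝ≥0∞}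
    (hn : ∀ r, 0 ≤ n r) (hd : ∀ r ∈ Icc s t, HasDerivWithinAt (fun r ↦ n r ^ 2) (h' r) (Icc s t) r)
    (hN : ∀ r ∈ Icc s t, ENNReal.ofReal (h' r) ≤ 2 * N r * ENNReal.ofReal (n r) ^ 2)
    (h₀ : n s = 0 → n t = 0) :
    ENNReal.ofReal (n t) ≤ ennExp (∫⁻ r in Icc s t, N r) * ENNReal.ofReal (n s) := by
  by_cases hs : n s = 0
  · simp [hs, h₀ hs]
  by_cases htop : ∫⁻ r in Icc s t, N r = ⊤
  · rw [htop, ennExp_top, ENNReal.top_mul]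
    · exact le_top
    · simpa using (hn s).lt_of_ne' hs
  set I : ℝ := (∫⁻ r in Icc s t, N r).toReal with hI
  -- as `n` may vanish, the logarithmic derivative is taken of `n ^ 2 + ε`
  have key (ε : ℝ) (hε : 0 < ε) : n t ^ 2 + ε ≤ Real.exp (2 * I) * (n s ^ 2 + ε) := by
    have h1 := ofReal_sub_le_lintegral_of_hasDerivWithinAt hst
      (u := fun r ↦ Real.log (n r ^ 2 + ε) / 2) (u' := fun r ↦ h' r / (n r ^ 2 + ε) / 2) (N := N)
      (fun r hr ↦ (((hd r hr).add_const ε).log (by positivity)).div_const 2) (fun r hr ↦ ?_)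
    · rw [← ENNReal.ofReal_toReal htop, ENNReal.ofReal_le_ofReal_iff ENNReal.toReal_nonneg] at h1
      have h2 : Real.log (n t ^ 2 + ε) ≤ 2 * I + Real.log (n s ^ 2 + ε) := by linarith
      calc n t ^ 2 + ε = Real.exp (Real.log (n t ^ 2 + ε)) :=
            (Real.exp_log (by positivity)).symm
        _ ≤ Real.exp (2 * I + Real.log (n s ^ 2 + ε)) := Real.exp_le_exp.2 h2
        _ = _ := by rw [Real.exp_add, Real.exp_log (by positivity)]
    · have hpos : 0 < n r ^ 2 + ε := by positivity
      have h2 : ENNReal.ofReal (h' r) ≤ N r * ENNReal.ofReal ((n r ^ 2 + ε) * 2) := by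
        refine (hN r hr).trans ?_
        rw [mul_comm 2 (N r), mul_assoc, ← ENNReal.ofReal_pow (hn r)]
        gcongr
        rw [mul_comm 2, ENNReal.ofReal_mul hpos.le]
        simp only [ENNReal.ofReal_ofNat]
        gcongr
        linarith
      rw [div_div, ENNReal.ofReal_div_of_pos (by positivity)]
      exact ENNReal.div_le_of_le_mul h2
  have hlim : n t ^ 2 ≤ Real.exp (2 * I) * n s ^ 2 := by
    refine le_of_forall_pos_le_add fun ε hε ↦ ?_
    have h1 := key (ε / Real.exp (2 * I)) (by positivity)
    rw [mul_add, mul_div_cancel₀ _ (Real.exp_pos _).ne'] at h1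
    have : 0 < ε / Real.exp (2 * I) := by positivity
    linarith
  have h2 : n t ≤ Real.exp I * n s := by
    refine abs_le_of_sq_le_sq' ?_ (by have := hn s; positivity) |>.2
    rw [mul_pow, ← Real.exp_nat_mul]
    exact_mod_cast hlim
  rw [← ENNReal.ofReal_toReal htop, ennExp_ofReal ENNReal.toReal_nonneg, ← ENNReal.ofReal_mul
    (Real.exp_pos _).le]
  exact ENNReal.ofReal_le_ofReal h2

/-! ### The metric and the Levi-Civita derivative in a chart -/

section TangentNorm

variable {E : Type*} [NormedAddCommGroup E] [NormedSpace ℝ E]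
  {M : Type*} [TopologicalSpace M] [ChartedSpace E M] [IsManifold 𝓘(ℝ, E) ∞ M]

theorem continuousLinearMapAt_trivializationAt_self (m : M) (v : TangentSpace 𝓘(ℝ, E) m) :
    (trivializationAt E (TangentSpace 𝓘(ℝ, E)) m).continuousLinearMapAt ℝ m v = v := by
  rw [TangentBundle.continuousLinearMapAt_trivializationAt_eq_core (mem_chart_source E m)]
  exact (tangentBundleCore 𝓘(ℝ, E) M).coordChange_self (achart E m) m (mem_chart_source E m) v

theorem symmL_trivializationAt_self (m : M) (v : E) :
    (trivializationAt E (TangentSpace 𝓘(ℝ, E)) m).symmL ℝ m v = v := by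
  rw [TangentBundle.symmL_trivializationAt_eq_core (mem_chart_source E m)]
  exact (tangentBundleCore 𝓘(ℝ, E) M).coordChange_self (achart E m) m (mem_chart_source E m) v

theorem chartField_extChartAt_self (m : M) (X : (x : M) → TangentSpace 𝓘(ℝ, E) x) :
    chartField m X (extChartAt 𝓘(ℝ, E) m m) = X m := by
  have key (x : M) (hx : x = m) :
      (trivializationAt E (TangentSpace 𝓘(ℝ, E)) m).continuousLinearMapAt ℝ x (X x) =
        (show E from X m) := by
    subst hx
    exact continuousLinearMapAt_trivializationAt_self x (X x)
  exact key _ (extChartAt_to_inv m)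

end TangentNorm

section TangentNorm

variable {E : Type*} [NormedAddCommGroup E] [NormedSpace ℝ E]
  {M : Type*} [TopologicalSpace M] [ChartedSpace E M]
  [RiemannianBundle (fun x : M ↦ TangentSpace 𝓘(ℝ, E) x)]

/-- The Riemannian norm of the tangent vector at `x` which corresponds to `v : E` under the
identification of the tangent space with the model space. As the type of `v` does not depend on `x`,
equalities of base points can be rewritten freely. -/
noncomputable def tangentNorm (x : M) (v : E) : ℝ :=
  @norm (TangentSpace 𝓘(ℝ, E) x) _ v

/-- The Riemannian scalar product of two tangent vectors at `x`, given as elements of the model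
space for the same reason as in `tangentNorm`. -/
noncomputable def tangentInner (x : M) (u v : E) : ℝ :=
  @inner ℝ (TangentSpace 𝓘(ℝ, E) x) _ u v

theorem tangentNorm_nonneg (x : M) (v : E) : 0 ≤ tangentNorm x v :=
  norm_nonneg (E := TangentSpace 𝓘(ℝ, E) x) _

theorem tangentNorm_zero (x : M) : tangentNorm x (0 : E) = 0 :=
  norm_zero (E := TangentSpace 𝓘(ℝ, E) x)

theorem tangentInner_self (x : M) (v : E) :
    tangentInner (E := E) x v v = tangentNorm (E := E) x v ^ 2 :=
  real_inner_self_eq_norm_sq (F := TangentSpace 𝓘(ℝ, E) x) v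

variable [IsManifold 𝓘(ℝ, E) ∞ M]

theorem chartMetric_apply (m : M) (y u v : E) :
    chartMetric m y u v = tangentInner (E := E) ((extChartAt 𝓘(ℝ, E) m).symm y)
      ((trivializationAt E (TangentSpace 𝓘(ℝ, E)) m).symmL ℝ ((extChartAt 𝓘(ℝ, E) m).symm y) u)
      ((trivializationAt E (TangentSpace 𝓘(ℝ, E)) m).symmL ℝ ((extChartAt 𝓘(ℝ, E) m).symm y) v) :=
  rfl

theorem chartMetric_comm (m : M) (y u v : E) : chartMetric m y u v = chartMetric m y v u :=
  real_inner_comm (F := TangentSpace 𝓘(ℝ, E) ((extChartAt 𝓘(ℝ, E) m).symm y)) _ _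

theorem chartMetric_extChartAt_self (m : M) (u v : E) :
    chartMetric m (extChartAt 𝓘(ℝ, E) m m) u v = tangentInner (E := E) m u v := by
  have key (x : M) (hx : x = m) :
      tangentInner (E := E) x ((trivializationAt E (TangentSpace 𝓘(ℝ, E)) m).symmL ℝ x u)
        ((trivializationAt E (TangentSpace 𝓘(ℝ, E)) m).symmL ℝ x v) =
          tangentInner (E := E) m u v := by
    subst hx
    exact congrArg₂ (tangentInner (E := E) x) (symmL_trivializationAt_self x u)
      (symmL_trivializationAt_self x v)
  exact key _ (extChartAt_to_inv m)

/-- The metric is a smooth section of a bundle of bilinear forms. Its coordinates are handled entry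
by entry, through the scalar products of the coordinate vector fields. -/
theorem differentiableAt_chartMetric [FiniteDimensional ℝ E]
    [IsContMDiffRiemannianBundle 𝓘(ℝ, E) ∞ E (fun x : M ↦ TangentSpace 𝓘(ℝ, E) x)] (m : M) :
    DifferentiableAt ℝ (chartMetric m) (extChartAt 𝓘(ℝ, E) m m) := by
  have hsec (v : E) : ContMDiffOn 𝓘(ℝ, E) (𝓘(ℝ, E).prod 𝓘(ℝ, E)) ∞
      (fun y ↦ (⟨(extChartAt 𝓘(ℝ, E) m).symm y,
        (trivializationAt E (TangentSpace 𝓘(ℝ, E)) m).symmL ℝ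
          ((extChartAt 𝓘(ℝ, E) m).symm y) v⟩ : TangentBundle 𝓘(ℝ, E) M))
      (extChartAt 𝓘(ℝ, E) m).target := by
    have h1 : ContMDiffOn 𝓘(ℝ, E) (𝓘(ℝ, E).prod 𝓘(ℝ, E)) ∞
        (fun y ↦ ((extChartAt 𝓘(ℝ, E) m).symm y, v)) (extChartAt 𝓘(ℝ, E) m).target :=
      (contMDiffOn_extChartAt_symm m).prodMk contMDiffOn_const
    refine ((Trivialization.contMDiffOn_symm
      (trivializationAt E (TangentSpace 𝓘(ℝ, E)) m)).comp h1 fun y hy ↦ ?_).congr fun y hy ↦ ?_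
    · rw [mem_preimage, Trivialization.mem_target]
      exact extChartAt_symm_mem_chartAt_source hy
    · rw [Trivialization.symmL_apply _ (extChartAt_symm_mem_chartAt_source hy)]
      exact (trivializationAt E (TangentSpace 𝓘(ℝ, E)) m).mk_symm
        (extChartAt_symm_mem_chartAt_source hy) v
  have hG : ContDiffOn ℝ 1 (chartMetric m) (extChartAt 𝓘(ℝ, E) m).target := by
    refine contDiffOn_clm_apply.2 fun u ↦ contDiffOn_clm_apply.2 fun v ↦ ?_
    have := ContMDiffOn.inner_bundle (IB := 𝓘(ℝ, E)) (n := ∞) (F := E)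
      (E := fun x : M ↦ TangentSpace 𝓘(ℝ, E) x) (hsec u) (hsec v)
    exact this.contDiffOn.of_le (by norm_cast)
  exact (hG.contDiffAt ((isOpen_extChartAt_target m).mem_nhds
    (mem_extChartAt_target m))).differentiableAt one_ne_zero

/-- In `⟨∇_w X, w⟩` the terms `∂_w g(X, w)` of the Christoffel symbols cancel, by the symmetry of
the metric, and `½ ∂_X g(w, w)` remains. -/
theorem inner_leviCivita [FiniteDimensional ℝ E]
    [IsContMDiffRiemannianBundle 𝓘(ℝ, E) ∞ E (fun x : M ↦ TangentSpace 𝓘(ℝ, E) x)]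
    (X : (x : M) → TangentSpace 𝓘(ℝ, E) x) (m : M) (w : TangentSpace 𝓘(ℝ, E) m) :
    tangentInner (E := E) m (leviCivita X m w) w =
      chartMetric m (extChartAt 𝓘(ℝ, E) m m)
        (fderiv ℝ (chartField m X) (extChartAt 𝓘(ℝ, E) m m) w) w +
      (1 / 2) * fderiv ℝ (chartMetric m) (extChartAt 𝓘(ℝ, E) m m) (X m) w w := by
  have hsymm (u v z : E) : fderiv ℝ (chartMetric m) (extChartAt 𝓘(ℝ, E) m m) u v z =
      fderiv ℝ (chartMetric m) (extChartAt 𝓘(ℝ, E) m m) u z v := by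
    have h1 := (differentiableAt_chartMetric (E := E) m).hasFDerivAt
    have h2 (v z : E) : HasFDerivAt (fun y ↦ chartMetric m y v z)
        (((fderiv ℝ (chartMetric m) (extChartAt 𝓘(ℝ, E) m m)).flip v).flip z)
        (extChartAt 𝓘(ℝ, E) m m) := by
      have h3 := (h1.clm_apply (hasFDerivAt_const v _)).clm_apply (hasFDerivAt_const z _)
      refine h3.congr_fderiv ?_
      ext; simp
    have h4 := h2 z v
    simp only [chartMetric_comm m _ z v] at h4
    exact congrArg (fun L : E →L[ℝ] ℝ ↦ L u) ((h2 v z).unique h4)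
  have h1 : tangentInner (E := E) m (christoffel m w (X m)) w = (1 / 2) *
      fderiv ℝ (chartMetric m) (extChartAt 𝓘(ℝ, E) m m) (X m) w w := by
    refine (InnerProductSpace.toDual_symm_apply (𝕜 := ℝ) (E := TangentSpace 𝓘(ℝ, E) m)).trans ?_
    change (1 / 2) * (fderiv ℝ (chartMetric m) (extChartAt 𝓘(ℝ, E) m m) w (X m) w +
      fderiv ℝ (chartMetric m) (extChartAt 𝓘(ℝ, E) m m) (X m) w w -
      fderiv ℝ (chartMetric m) (extChartAt 𝓘(ℝ, E) m m) w w (X m)) = _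
    rw [hsymm w w (X m)]
    ring
  have h2 := chartMetric_extChartAt_self (E := E) m
    (fderiv ℝ (chartField m X) (extChartAt 𝓘(ℝ, E) m m) w) w
  exact (inner_add_left (𝕜 := ℝ) (E := TangentSpace 𝓘(ℝ, E) m) _ _ _).trans
    (congrArg₂ (· + ·) h2.symm h1)

theorem leviCivita_smul [FiniteDimensional ℝ E]
    (X : (x : M) → TangentSpace 𝓘(ℝ, E) x) (m : M) (c : ℝ) (w : TangentSpace 𝓘(ℝ, E) m) :
    leviCivita X m (c • w) = c • leviCivita X m w := by
  have h1 : chartDeriv X m (c • w) = c • chartDeriv X m w :=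
    map_smul (fderiv ℝ (chartField m X) (extChartAt 𝓘(ℝ, E) m m)) c w
  have h2 : christoffelForm (E := E) (formDeriv (chartMetric m) (extChartAt 𝓘(ℝ, E) m m))
      (c • w) (X m) = c • christoffelForm (E := E)
        (formDeriv (chartMetric m) (extChartAt 𝓘(ℝ, E) m m)) w (X m) := by
    have hD (D : E →L[ℝ] E →L[ℝ] E →L[ℝ] ℝ) (c : ℝ) (w x : E) :
        christoffelForm D (c • w) x = c • christoffelForm D w x := by
      ext z
      change (1 / 2) * (D (c • w) x z + D x (c • w) z - D z (c • w) x) =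
        c * ((1 / 2) * (D w x z + D x w z - D z w x))
      have h3 : D (c • w) x z = c * D w x z :=
        congrArg (fun L : E →L[ℝ] E →L[ℝ] ℝ ↦ L x z) (D.map_smul c w)
      have h4 : D x (c • w) z = c * D x w z :=
        congrArg (fun L : E →L[ℝ] ℝ ↦ L z) ((D x).map_smul c w)
      have h5 : D z (c • w) x = c * D z w x :=
        congrArg (fun L : E →L[ℝ] ℝ ↦ L x) ((D z).map_smul c w)
      rw [h3, h4, h5]
      ring
    exact hD _ c w (X m)
  rw [leviCivita, leviCivita, christoffel, christoffel, h1, smul_add]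
  congr 1
  refine (congrArg _ h2).trans ?_
  exact map_smulₛₗ (InnerProductSpace.toDual ℝ (TangentSpace 𝓘(ℝ, E) m)).symm c _

theorem enorm_leviCivita_le [FiniteDimensional ℝ E]
    (X : (x : M) → TangentSpace 𝓘(ℝ, E) x) (m : M) (w : TangentSpace 𝓘(ℝ, E) m) :
    ‖leviCivita X m w‖ₑ ≤ nablaNorm X m * ‖w‖ₑ := by
  by_cases hw : ‖w‖ = 0
  · rw [norm_eq_zero] at hw
    have := leviCivita_smul X m 0 w
    rw [zero_smul, zero_smul] at this
    rw [hw, this]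
    simp
  · have h1 : ‖‖w‖⁻¹ • w‖ = 1 := by
      rw [norm_smul, norm_inv, norm_norm, inv_mul_cancel₀ hw]
    have h2 : ‖leviCivita X m (‖w‖⁻¹ • w)‖ₑ ≤ nablaNorm X m :=
      le_iSup₂ (f := fun (v : TangentSpace 𝓘(ℝ, E) m) (_ : ‖v‖ = 1) ↦ ‖leviCivita X m v‖ₑ) _ h1
    have h3 : w = ‖w‖ • (‖w‖⁻¹ • w) := by rw [smul_smul, mul_inv_cancel₀ hw, one_smul]
    calc ‖leviCivita X m w‖ₑ = ‖‖w‖ • leviCivita X m (‖w‖⁻¹ • w)‖ₑ := by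
          rw [← leviCivita_smul, ← h3]
      _ = ‖leviCivita X m (‖w‖⁻¹ • w)‖ₑ * ‖w‖ₑ := by rw [enorm_smul, enorm_norm, mul_comm]
      _ ≤ _ := by gcongr

end TangentNorm

/-! ### Growth of the differential of the flow -/

section QuadraticForm

variable {E : Type*} [NormedAddCommGroup E] [NormedSpace ℝ E]

theorem HasDerivAt.clm_apply_const {L : ℝ → E →L[ℝ] E} {L' : E →L[ℝ] E} {s : ℝ}
    (hL : HasDerivAt L L' s) (w : E) : HasDerivAt (fun r ↦ L r w) (L' w) s := by
  simpa using hL.clm_apply (hasDerivAt_const s w)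

theorem DifferentiableAt.hasDerivAt_comp {F : Type*} [NormedAddCommGroup F] [NormedSpace ℝ F]
    {G : E → F} {c : ℝ → E} {y c' : E} {s : ℝ}
    (hG : DifferentiableAt ℝ G y) (hc : HasDerivAt c c' s) (hcs : c s = y) :
    HasDerivAt (fun r ↦ G (c r)) (fderiv ℝ G y c') s := by
  subst hcs
  exact hG.hasFDerivAt.comp_hasDerivAt s hc

theorem HasDerivAt.form_apply_self {K : ℝ → E →L[ℝ] E →L[ℝ] ℝ} {K' : E →L[ℝ] E →L[ℝ] ℝ}
    {v : ℝ → E} {v' : E} {s : ℝ} (hK : HasDerivAt K K' s) (hv : HasDerivAt v v' s) :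
    HasDerivAt (fun r ↦ K r (v r) (v r)) (K' (v s) (v s) + K s v' (v s) + K s (v s) v') s :=
  (hK.clm_apply hv).clm_apply hv

theorem DifferentiableAt.hasDerivAt_form_apply {G : E → E →L[ℝ] E →L[ℝ] ℝ}
    {c v : ℝ → E} {y c' w v' : E} {s : ℝ}
    (hG : DifferentiableAt ℝ G y) (hc : HasDerivAt c c' s) (hcs : c s = y)
    (hv : HasDerivAt v v' s) (hvs : v s = w) :
    HasDerivAt (fun r ↦ G (c r) (v r) (v r)) (fderiv ℝ G y c' w w + G y v' w + G y w v') s := by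
  -- the codomain is explicit because unification does not find its normed space structure
  have h1 := DifferentiableAt.hasDerivAt_comp (F := E →L[ℝ] E →L[ℝ] ℝ) hG hc hcs
  subst hcs hvs
  exact HasDerivAt.form_apply_self h1 hv

end QuadraticForm

section FlowDifferential

variable {E : Type*} [NormedAddCommGroup E] [NormedSpace ℝ E]
  {M : Type*} [TopologicalSpace M] [ChartedSpace E M]
  {a b : ℝ} {X : ℝ → (m : M) → TangentSpace 𝓘(ℝ, E) m}

theorem mfderiv_timeDepFlow_self (hXc : CompleteTimeDepField (Icc a b) X) {s : ℝ}
    (hs : s ∈ Icc a b) (x : M) (v : E) :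
    (mfderiv 𝓘(ℝ, E) 𝓘(ℝ, E) (timeDepFlow (Icc a b) X s s) x v : E) = v := by
  have h1 : timeDepFlow (Icc a b) X s s = id := funext fun z ↦ timeDepFlow_self hXc hs z
  have h2 : HasMFDerivAt 𝓘(ℝ, E) 𝓘(ℝ, E) (timeDepFlow (Icc a b) X s s) x
      (ContinuousLinearMap.id ℝ (TangentSpace 𝓘(ℝ, E) x)) := by
    rw [h1]; exact hasMFDerivAt_id x
  exact congrArg (fun L : E →L[ℝ] E ↦ L v) h2.mfderiv

end FlowDifferential

section NormGrowth

open Filter Topology Metric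

variable {E : Type*} [NormedAddCommGroup E] [NormedSpace ℝ E] [FiniteDimensional ℝ E]
  {M : Type*} [TopologicalSpace M] [ChartedSpace E M] [IsManifold 𝓘(ℝ, E) ∞ M] [T2Space M]
  {a b : ℝ} {X : ℝ → (m : M) → TangentSpace 𝓘(ℝ, E) m}

theorem hasMFDerivAt_timeDepFlow (hab : a < b)
    (hX : SmoothTimeDepField (Icc a b) X) (hXc : CompleteTimeDepField (Icc a b) X) {r s : ℝ}
    (hr : r ∈ Icc a b) (hs : s ∈ Icc a b) (x : M) :
    HasMFDerivAt 𝓘(ℝ, E) 𝓘(ℝ, E) (timeDepFlow (Icc a b) X r s) x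
      (mfderiv 𝓘(ℝ, E) 𝓘(ℝ, E) (timeDepFlow (Icc a b) X r s) x) :=
  ((contMDiff_timeDepFlow hab hX hXc hr hs).mdifferentiable one_ne_zero x).hasMFDerivAt

theorem mfderiv_timeDepFlow_comp (hab : a < b)
    (hX : SmoothTimeDepField (Icc a b) X) (hXc : CompleteTimeDepField (Icc a b) X) {r s' s : ℝ}
    (hr : r ∈ Icc a b) (hs' : s' ∈ Icc a b) (hs : s ∈ Icc a b) (x : M) (v : E) :
    (mfderiv 𝓘(ℝ, E) 𝓘(ℝ, E) (timeDepFlow (Icc a b) X r s) x v : E) =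
      mfderiv 𝓘(ℝ, E) 𝓘(ℝ, E) (timeDepFlow (Icc a b) X r s') (timeDepFlow (Icc a b) X s' s x)
        (mfderiv 𝓘(ℝ, E) 𝓘(ℝ, E) (timeDepFlow (Icc a b) X s' s) x v) := by
  have h4 : timeDepFlow (Icc a b) X r s =
      timeDepFlow (Icc a b) X r s' ∘ timeDepFlow (Icc a b) X s' s :=
    funext fun z ↦ (timeDepFlow_comp hX hXc hr hs' hs z).symm
  have h5 := (hasMFDerivAt_timeDepFlow hab hX hXc hr hs' (timeDepFlow (Icc a b) X s' s x)).comp x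
    (hasMFDerivAt_timeDepFlow hab hX hXc hs' hs x)
  rw [← h4] at h5
  exact congrArg (fun L : E →L[ℝ] E ↦ L v) h5.mfderiv

variable [RiemannianBundle (fun x : M ↦ TangentSpace 𝓘(ℝ, E) x)]
  [IsContMDiffRiemannianBundle 𝓘(ℝ, E) ∞ E (fun x : M ↦ TangentSpace 𝓘(ℝ, E) x)]

/-- The derivative at `r = s` of the squared norm of `Dμ_{r,s}(x) w` is `2 ⟨∇_w X, w⟩`. In the
preferred chart at `x`, the variational equation gives `2 ⟨∂_w X, w⟩ + (∂_X g)(w, w)`, and the other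
two derivatives of the metric in the Christoffel symbols cancel. -/
theorem hasDerivWithinAt_tangentNorm_sq_self (hab : a < b)
    (hX : SmoothTimeDepField (Icc a b) X) (hXc : CompleteTimeDepField (Icc a b) X) {s : ℝ}
    (hs : s ∈ Icc a b) (x : M) (w : E) :
    HasDerivWithinAt (fun r ↦ tangentNorm (E := E) (timeDepFlow (Icc a b) X r s x)
      (mfderiv 𝓘(ℝ, E) 𝓘(ℝ, E) (timeDepFlow (Icc a b) X r s) x w) ^ 2)
      (2 * tangentInner (E := E) x (leviCivita (X s) x w) w) (Icc a b) s := by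
  obtain ⟨δ, ρ, Φ, V, h⟩ := exists_isChartFlow hab hX hXc hs x
  set e := extChartAt 𝓘(ℝ, E) x with he
  have hsJ : s ∈ Icc a b ∩ ball s δ := ⟨hs, mem_ball_self h.time_pos⟩
  have hxs : x ∈ (chartAt E x).source := mem_chart_source E x
  have hxB : e x ∈ ball (e x) ρ := mem_ball_self h.radius_pos
  have hchart (r : ℝ) (hr : r ∈ Icc a b ∩ ball s δ) :
      tangentNorm (E := E) (timeDepFlow (Icc a b) X r s x)
        (mfderiv 𝓘(ℝ, E) 𝓘(ℝ, E) (timeDepFlow (Icc a b) X r s) x w) ^ 2 =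
      chartMetric x (Φ r s (e x)) (V r s (e x) w) (V r s (e x) w) := by
    have h1 := (h.hasMFDerivAt hr hsJ hxs hxB).congr_of_eventuallyEq
      (h.eventuallyEq hr hsJ hxs hxB)
    have h2 : (mfderiv 𝓘(ℝ, E) 𝓘(ℝ, E) (timeDepFlow (Icc a b) X r s) x w : E) =
        (trivializationAt E (TangentSpace 𝓘(ℝ, E)) x).symmL ℝ (e.symm (Φ r s (e x)))
          (V r s (e x) w) := by
      refine (congrArg (fun L : E →L[ℝ] E ↦ L w) h1.mfderiv).trans ?_
      exact congrArg (fun z : E ↦ (trivializationAt E (TangentSpace 𝓘(ℝ, E)) x).symmL ℝ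
        (e.symm (Φ r s (e x))) (V r s (e x) z)) (continuousLinearMapAt_trivializationAt_self x w)
    rw [chartMetric_apply]
    refine Eq.trans ?_ (tangentInner_self (E := E) (e.symm (Φ r s (e x))) _).symm
    rw [h.timeDepFlow_eq r hr s hsJ x hxs hxB]
    exact congrArg (fun z : E ↦ tangentNorm (E := E) (e.symm (Φ r s (e x))) z ^ 2) h2
  have hΦ0 : Φ s s (e x) = e x := h.isLocalFlow.apply_self s hsJ _ hxB
  have hV0 : V s s (e x) = ContinuousLinearMap.id ℝ E := h.isLocalFlow.deriv_self s hsJ _ hxB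
  have hΦd : HasDerivAt (fun r ↦ Φ r s (e x)) (chartField x (X s) (e x)) s := by
    have := h.isLocalFlow.hasDerivAt s hsJ s hsJ _ hxB
    rwa [hΦ0] at this
  have hVd : HasDerivAt (fun r ↦ V r s (e x) w) (fderiv ℝ (chartField x (X s)) (e x) w) s := by
    have := (h.isLocalFlow.hasDerivAt_deriv s hsJ s hsJ _ hxB).clm_apply_const w
    rwa [hΦ0, hV0] at this
  have hd := (differentiableAt_chartMetric (E := E) x).hasDerivAt_form_apply hΦd hΦ0 hVd
    (congrArg (fun L : E →L[ℝ] E ↦ L w) hV0)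
  refine (hd.hasDerivWithinAt (s := Icc a b)).congr_of_eventuallyEq ?_ (hchart s hsJ) |>.congr_deriv
    ?_
  · filter_upwards [self_mem_nhdsWithin, mem_nhdsWithin_of_mem_nhds (ball_mem_nhds s h.time_pos)]
      with r hr1 hr2
    exact hchart r ⟨hr1, hr2⟩
  · have h3 := inner_leviCivita (E := E) (X s) x w
    have h4 : (chartField x (X s) (e x) : E) = X s x := chartField_extChartAt_self x (X s)
    have h5 := chartMetric_comm x (e x) w (fderiv ℝ (chartField x (X s)) (e x) w)
    have h6 : fderiv ℝ (chartMetric x) (e x) (chartField x (X s) (e x)) w w =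
      fderiv ℝ (chartMetric x) (e x) (X s x) w w :=
      congrArg (fun z : E ↦ fderiv ℝ (chartMetric x) (e x) z w w) h4
    refine (congrArg₂ (fun z z' ↦ z + _ + z') h6 h5).trans ?_
    refine Eq.trans ?_ (congrArg (2 * ·) h3).symm
    simp only [← he, ContinuousLinearMap.id_apply]
    ring

/-- The derivative of `|Dμ_{r,s}(x) v|²` at an arbitrary time `r₁`. The flow property moves the
initial time from `s` to `r₁`. -/
theorem hasDerivWithinAt_tangentNorm_sq (hab : a < b)
    (hX : SmoothTimeDepField (Icc a b) X) (hXc : CompleteTimeDepField (Icc a b) X) {r₁ s : ℝ}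
    (hr₁ : r₁ ∈ Icc a b) (hs : s ∈ Icc a b) (x : M) (v : E) :
    HasDerivWithinAt (fun r ↦ tangentNorm (E := E) (timeDepFlow (Icc a b) X r s x)
      (mfderiv 𝓘(ℝ, E) 𝓘(ℝ, E) (timeDepFlow (Icc a b) X r s) x v) ^ 2)
      (2 * tangentInner (E := E) (timeDepFlow (Icc a b) X r₁ s x)
        (leviCivita (X r₁) (timeDepFlow (Icc a b) X r₁ s x)
          (mfderiv 𝓘(ℝ, E) 𝓘(ℝ, E) (timeDepFlow (Icc a b) X r₁ s) x v))
        (mfderiv 𝓘(ℝ, E) 𝓘(ℝ, E) (timeDepFlow (Icc a b) X r₁ s) x v)) (Icc a b) r₁ := by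
  have h1 := hasDerivWithinAt_tangentNorm_sq_self hab hX hXc hr₁ (timeDepFlow (Icc a b) X r₁ s x)
    (mfderiv 𝓘(ℝ, E) 𝓘(ℝ, E) (timeDepFlow (Icc a b) X r₁ s) x v)
  refine h1.congr_of_mem (fun r hr ↦ ?_) hr₁
  rw [timeDepFlow_comp hX hXc hr hr₁ hs]
  exact congrArg (fun z : E ↦ tangentNorm (E := E) (timeDepFlow (Icc a b) X r s x) z ^ 2)
    (mfderiv_timeDepFlow_comp hab hX hXc hr hr₁ hs x v)

/-- The differential of the flow grows at most at the rate `|∇X|` along the trajectory, as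
`½ d/dr |w|² = ⟨∇_w X, w⟩ ≤ |∇X| |w|²` for `w = Dμ_{r,s}(x) v`. -/
theorem enorm_mfderiv_timeDepFlow_le (hab : a < b)
    (hX : SmoothTimeDepField (Icc a b) X) (hXc : CompleteTimeDepField (Icc a b) X) {s t : ℝ}
    (hst : s ≤ t) (ht : t ∈ Icc a b) (hs : s ∈ Icc a b) (x : M) (v : TangentSpace 𝓘(ℝ, E) x) :
    ‖mfderiv 𝓘(ℝ, E) 𝓘(ℝ, E) (timeDepFlow (Icc a b) X t s) x v‖ₑ ≤
      ennExp (∫⁻ r in Icc s t, nablaNorm (X r) (timeDepFlow (Icc a b) X r s x)) * ‖v‖ₑ := by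
  have hsub : Icc s t ⊆ Icc a b := Icc_subset_Icc hs.1 ht.2
  set D : ℝ → E := fun r ↦ mfderiv 𝓘(ℝ, E) 𝓘(ℝ, E) (timeDepFlow (Icc a b) X r s) x v with hD
  have key := ofReal_le_ennExp_lintegral_mul hst
    (n := fun r ↦ tangentNorm (E := E) (timeDepFlow (Icc a b) X r s x) (D r))
    (N := fun r ↦ nablaNorm (X r) (timeDepFlow (Icc a b) X r s x))
    (fun r ↦ tangentNorm_nonneg (E := E) _ _)
    (fun r hr ↦ (hasDerivWithinAt_tangentNorm_sq hab hX hXc (hsub hr) hs x v).mono hsub)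
    (fun r hr ↦ ?_) (fun h0 ↦ ?_)
  · have h1 : D s = v := mfderiv_timeDepFlow_self hXc hs x v
    rw [h1, timeDepFlow_self hXc hs] at key
    have h2 (y : M) (z : TangentSpace 𝓘(ℝ, E) y) :
        ENNReal.ofReal (tangentNorm (E := E) y z) = ‖z‖ₑ := ofReal_norm z
    rw [h2, h2] at key
    exact key
  · set y := timeDepFlow (Icc a b) X r s x
    have h1 : tangentInner (E := E) y (leviCivita (X r) y (D r)) (D r) ≤
        tangentNorm (E := E) y (leviCivita (X r) y (D r)) * tangentNorm (E := E) y (D r) :=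
      real_inner_le_norm (F := TangentSpace 𝓘(ℝ, E) y) _ _
    have h2 (y : M) (z : TangentSpace 𝓘(ℝ, E) y) :
        ENNReal.ofReal (tangentNorm (E := E) y z) = ‖z‖ₑ := ofReal_norm z
    have h3 : ENNReal.ofReal (tangentNorm (E := E) y (leviCivita (X r) y (D r))) ≤
        nablaNorm (X r) y * ENNReal.ofReal (tangentNorm (E := E) y (D r)) := by
      rw [h2, h2]
      exact enorm_leviCivita_le (X r) y (D r)
    generalize tangentInner (E := E) y (leviCivita (X r) y (D r)) (D r) = i at h1 ⊢
    generalize tangentNorm (E := E) y (leviCivita (X r) y (D r)) = p at h1 h3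
    have hn := tangentNorm_nonneg (E := E) y (D r)
    generalize tangentNorm (E := E) y (D r) = n at hn h1 h3 ⊢
    calc ENNReal.ofReal (2 * i) ≤ ENNReal.ofReal (2 * (p * n)) :=
          ENNReal.ofReal_le_ofReal (by linarith)
      _ = 2 * (ENNReal.ofReal p * ENNReal.ofReal n) := by
          rw [ENNReal.ofReal_mul zero_le_two, ENNReal.ofReal_mul' hn, ENNReal.ofReal_ofNat]
      _ ≤ 2 * (nablaNorm (X r) y * ENNReal.ofReal n * ENNReal.ofReal n) := by gcongr
      _ = 2 * nablaNorm (X r) y * ENNReal.ofReal n ^ 2 := by ring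
  · -- the differential is linear, so it sends zero to zero even if the rate is infinite
    have h1 : D s = v := mfderiv_timeDepFlow_self hXc hs x v
    have h2 : v = 0 := by
      rw [h1, timeDepFlow_self hXc hs] at h0
      exact norm_eq_zero.1 h0
    have h3 : D t = (0 : E) := by
      rw [hD, h2]
      exact map_zero (mfderiv 𝓘(ℝ, E) 𝓘(ℝ, E) (timeDepFlow (Icc a b) X t s) x)
    rw [h3, tangentNorm_zero]

end NormGrowth

/-! ### Curves transported by the flow -/

section Curves

open Filter Topology Metric

variable {E : Type*} [NormedAddCommGroup E] [NormedSpace ℝ E]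
  {M : Type*} [TopologicalSpace M] [ChartedSpace E M] [IsManifold 𝓘(ℝ, E) ∞ M]
  {a b : ℝ} {X : ℝ → (m : M) → TangentSpace 𝓘(ℝ, E) m}

theorem contMDiffWithinAt_of_eqOn_extChartAt_symm {J S : Set ℝ} {s : ℝ} (hs : s ∈ S)
    (hS : S ∈ 𝓝[J] s) {γ : ℝ → M} {x₀ : M} {η : ℝ → E} (hη : ContDiffOn ℝ 1 η S)
    (hmem : MapsTo η S (extChartAt 𝓘(ℝ, E) x₀).target)
    (heq : EqOn γ (fun τ ↦ (extChartAt 𝓘(ℝ, E) x₀).symm (η τ)) S) :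
    ContMDiffWithinAt 𝓘(ℝ, ℝ) 𝓘(ℝ, E) 1 γ J s := by
  have h1 : ContMDiffOn 𝓘(ℝ, ℝ) 𝓘(ℝ, E) 1 (fun τ ↦ (extChartAt 𝓘(ℝ, E) x₀).symm (η τ)) S :=
    (contMDiffOn_extChartAt_symm x₀).comp hη.contMDiffOn hmem
  exact ((h1.congr heq) s hs).mono_of_mem_nhdsWithin hS

theorem ContinuousWithinAt.exists_inter_ball_subset_preimage {J : Set ℝ} {s : ℝ} {γ : ℝ → M}
    (hγ : ContinuousWithinAt γ J s) {N : Set M} (hN : N ∈ 𝓝 (γ s)) {δ : ℝ} (hδ : 0 < δ) :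
    ∃ ε > 0, J ∩ ball s ε ⊆ ball s δ ∩ γ ⁻¹' N := by
  obtain ⟨ε, hε, h⟩ := Metric.mem_nhdsWithin_iff.1
    (inter_mem (mem_nhdsWithin_of_mem_nhds (ball_mem_nhds s hδ)) (hγ hN))
  exact ⟨ε, hε, by rwa [inter_comm]⟩

/-- Solutions are `C^1`: the derivative is continuous because the field is. -/
theorem IsSolutionOn.contMDiffOn (hab : a < b) (hX : SmoothTimeDepField (Icc a b) X) {γ : ℝ → M}
    (hγ : IsSolutionOn (Icc a b) X γ) :
    ContMDiffOn 𝓘(ℝ, ℝ) 𝓘(ℝ, E) 1 γ (Icc a b) := by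
  intro s hs
  set e := extChartAt 𝓘(ℝ, E) (γ s) with he
  obtain ⟨ε, hε, hsub⟩ := (hγ s hs).continuousWithinAt.exists_inter_ball_subset_preimage
    ((chartAt E (γ s)).open_source.mem_nhds (mem_chart_source E (γ s))) zero_lt_one
  set S := Icc a b ∩ ball s ε with hS
  have hSu : UniqueDiffOn ℝ S := (uniqueDiffOn_Icc hab).inter isOpen_ball
  have hsource (r : ℝ) (hr : r ∈ S) : γ r ∈ e.source := by
    rw [he, extChartAt_source]; exact (hsub hr).2
  have hder (r : ℝ) (hr : r ∈ S) :
      HasDerivWithinAt (fun τ ↦ e (γ τ)) (chartField (γ s) (X r) (e (γ r))) S r := by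
    have h1 := (hasDerivWithinAt_extChartAt_comp (hsub hr).2 (hγ r hr.1)).mono
      (inter_subset_left : S ⊆ Icc a b)
    rw [chartField, ← he, e.left_inv (hsource r hr)]
    exact h1
  have hmaps : MapsTo (fun τ ↦ e (γ τ)) S e.target := fun r hr ↦ e.map_source (hsource r hr)
  have hcont : ContinuousOn (fun τ ↦ e (γ τ)) S := fun r hr ↦ (hder r hr).continuousWithinAt
  refine contMDiffWithinAt_of_eqOn_extChartAt_symm (S := S) (η := fun τ ↦ e (γ τ)) (x₀ := γ s)
    ⟨hs, mem_ball_self hε⟩ (inter_mem self_mem_nhdsWithin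
      (mem_nhdsWithin_of_mem_nhds (ball_mem_nhds s hε))) ?_ hmaps
    fun r hr ↦ (e.left_inv (hsource r hr)).symm
  rw [contDiffOn_one_iff_derivWithin hSu]
  refine ⟨fun r hr ↦ (hder r hr).differentiableWithinAt, ?_⟩
  refine ContinuousOn.congr ?_ fun r hr ↦ (hder r hr).derivWithin (hSu r hr)
  exact (contDiffOn_chartField hX (γ s)).continuousOn.comp (f := fun r ↦ (r, e (γ r)))
    (continuousOn_id.prodMk hcont) fun r hr ↦ ⟨hr.1, hmaps hr⟩

variable [FiniteDimensional ℝ E] [T2Space M]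

/-- Moving each point `p τ` of a `C^1` curve from time `τ` to the fixed time `s` along the flow
gives a curve which is `C^1` at `s`, with derivative `p' - X_s(p s)` there. -/
theorem contMDiffWithinAt_timeDepFlow_curve_self (hab : a < b)
    (hX : SmoothTimeDepField (Icc a b) X) (hXc : CompleteTimeDepField (Icc a b) X) {p : ℝ → M}
    (hp : ContMDiffOn 𝓘(ℝ, ℝ) 𝓘(ℝ, E) 1 p (Icc a b)) {s : ℝ} (hs : s ∈ Icc a b)
    {p' : TangentSpace 𝓘(ℝ, E) (p s)}
    (hp' : HasMFDerivWithinAt 𝓘(ℝ, ℝ) 𝓘(ℝ, E) p (Icc a b) s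
      ((1 : ℝ →L[ℝ] ℝ).smulRight p')) :
    ContMDiffWithinAt 𝓘(ℝ, ℝ) 𝓘(ℝ, E) 1 (fun τ ↦ timeDepFlow (Icc a b) X s τ (p τ)) (Icc a b) s ∧
      HasMFDerivWithinAt 𝓘(ℝ, ℝ) 𝓘(ℝ, E) (fun τ ↦ timeDepFlow (Icc a b) X s τ (p τ)) (Icc a b) s
        ((1 : ℝ →L[ℝ] ℝ).smulRight (show E from p' - X s (p s))) := by
  obtain ⟨δ, ρ, Φ, V, h⟩ := exists_isChartFlow hab hX hXc hs (p s)
  set e := extChartAt 𝓘(ℝ, E) (p s) with he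
  have hsJ : s ∈ Icc a b ∩ ball s δ := ⟨hs, mem_ball_self h.time_pos⟩
  have hxB : e (p s) ∈ ball (e (p s)) ρ := mem_ball_self h.radius_pos
  have hxs : p s ∈ (chartAt E (p s)).source := mem_chart_source E (p s)
  obtain ⟨ε, hε, hsub⟩ := hp'.continuousWithinAt.exists_inter_ball_subset_preimage
    h.mem_nhds_self h.time_pos
  set S := Icc a b ∩ ball s ε with hS
  have hSu : UniqueDiffOn ℝ S := (uniqueDiffOn_Icc hab).inter isOpen_ball
  have hSn (r : ℝ) (hr : r ∈ S) : S ∈ 𝓝[Icc a b] r :=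
    inter_mem self_mem_nhdsWithin (mem_nhdsWithin_of_mem_nhds (isOpen_ball.mem_nhds hr.2))
  have hsS : s ∈ S := ⟨hs, mem_ball_self hε⟩
  have hSJ : S ⊆ Icc a b ∩ ball s δ := fun r hr ↦ ⟨hr.1, (hsub hr).1⟩
  have hord : (Icc a b ∩ ball s δ).OrdConnected :=
    ((convex_Icc a b).inter (convex_ball s δ)).ordConnected
  have hf : ContinuousOn (Function.uncurry fun r y ↦ chartField (p s) (X r) y)
      ((Icc a b ∩ ball s δ) ×ˢ e.target) :=
    (contDiffOn_chartField hX (p s)).continuousOn.mono (prod_mono inter_subset_left le_rfl)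
  have heq : EqOn (fun τ ↦ timeDepFlow (Icc a b) X s τ (p τ))
      (fun τ ↦ e.symm (Φ s τ (e (p τ)))) S := fun τ hτ ↦
    h.timeDepFlow_eq s hsJ τ (hSJ hτ) (p τ) (hsub hτ).2.1 (hsub hτ).2.2
  have hq : ContDiffOn ℝ 1 (fun τ ↦ e (p τ)) S := by
    rw [← contMDiffOn_iff_contDiffOn]
    exact (contMDiffOn_extChartAt (I := 𝓘(ℝ, E)) (n := 1) (x := p s)).comp
      (hp.mono inter_subset_left) fun τ hτ ↦ (hsub hτ).2.1
  have hΦ0 : Φ s s (e (p s)) = e (p s) := h.isLocalFlow.apply_self s hsJ _ hxB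
  have hV0 : V s s (e (p s)) = ContinuousLinearMap.id ℝ E := h.isLocalFlow.deriv_self s hsJ _ hxB
  constructor
  · refine contMDiffWithinAt_of_eqOn_extChartAt_symm hsS (hSn s hsS) ?_ ?_ heq
    · exact h.isLocalFlow.contDiffOn_comp hord isOpen_ball hf hsJ hSJ hSu
        (fun r hr ↦ nhdsWithin_mono r inter_subset_left (hSn r hr)) (fun r hr ↦ (hsub hr).2.2)
        h.ball_subset hq
    · exact fun τ hτ ↦ h.isLocalFlow.mem s hsJ τ (hSJ hτ) _ (hsub hτ).2.2
  · have h1 : HasDerivWithinAt (fun τ ↦ e (p τ)) p' (Icc a b) s :=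
      (hasDerivWithinAt_extChartAt_comp hxs hp').congr_deriv
        (continuousLinearMapAt_trivializationAt_self (p s) p')
    have h2 : HasDerivWithinAt (fun τ ↦ Φ s τ (e (p τ))) (show E from p' - X s (p s))
        (Icc a b) s := by
      have h3 := h.isLocalFlow.hasDerivWithinAt_comp hord isOpen_ball hf hsJ hsJ hxB
        (h1.mono inter_subset_left)
      have hmem : Icc a b ∩ ball s δ ∈ 𝓝[Icc a b] s :=
        inter_mem self_mem_nhdsWithin (mem_nhdsWithin_of_mem_nhds (ball_mem_nhds s h.time_pos))
      refine (h3.mono_of_mem_nhdsWithin hmem).congr_deriv ?_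
      refine (congrArg (fun L : E →L[ℝ] E ↦ L _) hV0).trans ?_
      exact congrArg (fun z : E ↦ (show E from p') - z) (chartField_extChartAt_self (p s) (X s))
    have h3 := hasMFDerivWithinAt_extChartAt_symm_comp (x₀ := p s)
      (h.isLocalFlow.mem s hsJ s hsJ _ hxB) h2
    have h4 := h3.congr_of_eventuallyEq (eventually_of_mem (hSn s hsS) heq) (heq hsS)
    refine h4.congr_mfderiv ?_
    have key (y : M) (hy : y = p s) (v : E) :
        ((trivializationAt E (TangentSpace 𝓘(ℝ, E)) (p s)).symmL ℝ y v : E) = v := by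
      subst hy
      exact symmL_trivializationAt_self (p s) v
    have h5 : e.symm (Φ s s (e (p s))) = p s := by rw [hΦ0]; exact extChartAt_to_inv (p s)
    exact congrArg (fun z : E ↦ (1 : ℝ →L[ℝ] ℝ).smulRight z) (key _ h5 _)

/-- The curve `τ ↦ μ_{t,τ}(p τ)` is `C^1`, with derivative `Dμ_{t,s}(p s) (p' s - X_s(p s))`. -/
theorem contMDiffWithinAt_timeDepFlow_curve (hab : a < b)
    (hX : SmoothTimeDepField (Icc a b) X) (hXc : CompleteTimeDepField (Icc a b) X) {p : ℝ → M}
    (hp : ContMDiffOn 𝓘(ℝ, ℝ) 𝓘(ℝ, E) 1 p (Icc a b)) {s t : ℝ} (hs : s ∈ Icc a b)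
    (ht : t ∈ Icc a b) {p' : TangentSpace 𝓘(ℝ, E) (p s)}
    (hp' : HasMFDerivWithinAt 𝓘(ℝ, ℝ) 𝓘(ℝ, E) p (Icc a b) s
      ((1 : ℝ →L[ℝ] ℝ).smulRight p')) :
    ContMDiffWithinAt 𝓘(ℝ, ℝ) 𝓘(ℝ, E) 1 (fun τ ↦ timeDepFlow (Icc a b) X t τ (p τ)) (Icc a b) s ∧
      HasMFDerivWithinAt 𝓘(ℝ, ℝ) 𝓘(ℝ, E) (fun τ ↦ timeDepFlow (Icc a b) X t τ (p τ)) (Icc a b) s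
        ((1 : ℝ →L[ℝ] ℝ).smulRight (show E from
          mfderiv 𝓘(ℝ, E) 𝓘(ℝ, E) (timeDepFlow (Icc a b) X t s) (p s) (p' - X s (p s)))) := by
  obtain ⟨h1, h2⟩ := contMDiffWithinAt_timeDepFlow_curve_self hab hX hXc hp hs hp'
  have h0 : timeDepFlow (Icc a b) X s s (p s) = p s := timeDepFlow_self hXc hs _
  have heq : EqOn (fun τ ↦ timeDepFlow (Icc a b) X t τ (p τ))
      (timeDepFlow (Icc a b) X t s ∘ fun τ ↦ timeDepFlow (Icc a b) X s τ (p τ)) (Icc a b) :=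
    fun τ hτ ↦ (timeDepFlow_comp hX hXc ht hs hτ _).symm
  constructor
  · exact ((contMDiff_timeDepFlow hab hX hXc ht hs _).comp_contMDiffWithinAt s h1).congr heq
      (heq hs)
  · have h3 : HasMFDerivAt 𝓘(ℝ, E) 𝓘(ℝ, E) (timeDepFlow (Icc a b) X t s)
        (timeDepFlow (Icc a b) X s s (p s)) (show E →L[ℝ] E from
          mfderiv 𝓘(ℝ, E) 𝓘(ℝ, E) (timeDepFlow (Icc a b) X t s) (p s)) := by
      rw [h0]
      exact hasMFDerivAt_timeDepFlow hab hX hXc ht hs (p s)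
    have h4 := (h3.comp_hasMFDerivWithinAt s h2).congr_of_eventuallyEq
      (eventually_of_mem self_mem_nhdsWithin heq) (heq hs)
    refine h4.congr_mfderiv ?_
    exact ContinuousLinearMap.ext fun (c : ℝ) ↦
      map_smul (mfderiv 𝓘(ℝ, E) 𝓘(ℝ, E) (timeDepFlow (Icc a b) X t s) (p s)) c _

end Curves

/-! ### Length estimates -/

section Estimates

variable {E : Type*} [NormedAddCommGroup E] [NormedSpace ℝ E]
  {M : Type*} [TopologicalSpace M] [ChartedSpace E M]
  [RiemannianBundle (fun x : M ↦ TangentSpace 𝓘(ℝ, E) x)]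

theorem pathELength_eq_lintegral_of_hasMFDerivWithinAt {γ : ℝ → M} {a t : ℝ} (hat : a < t)
    {γ' : (s : ℝ) → TangentSpace 𝓘(ℝ, E) (γ s)}
    (hγ : ∀ s ∈ Icc a t, HasMFDerivWithinAt 𝓘(ℝ, ℝ) 𝓘(ℝ, E) γ (Icc a t) s
      ((1 : ℝ →L[ℝ] ℝ).smulRight (γ' s))) :
    Manifold.pathELength 𝓘(ℝ, E) γ a t = ∫⁻ s in Icc a t, ‖γ' s‖ₑ := by
  rw [Manifold.pathELength_eq_lintegral_mfderivWithin_Icc]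
  refine setLIntegral_congr_fun measurableSet_Icc fun s hs ↦ ?_
  have h1 := (hγ s hs).mfderivWithin ((uniqueDiffOn_Icc hat s hs).uniqueMDiffWithinAt)
  have h2 : (mfderivWithin 𝓘(ℝ, ℝ) 𝓘(ℝ, E) γ (Icc a t) s (1 : ℝ) : E) = γ' s :=
    (congrArg (fun L : ℝ →L[ℝ] E ↦ L 1) h1).trans (one_smul ℝ (γ' s : E))
  exact congrArg (fun z : TangentSpace 𝓘(ℝ, E) (γ s) ↦ ‖z‖ₑ) h2

theorem riemannianEDist_le_lintegral {γ : ℝ → M} {a t : ℝ} (hat : a < t)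
    (hγ : ContMDiffOn 𝓘(ℝ, ℝ) 𝓘(ℝ, E) 1 γ (Icc a t))
    {γ' : (s : ℝ) → TangentSpace 𝓘(ℝ, E) (γ s)}
    (hγ' : ∀ s ∈ Icc a t, HasMFDerivWithinAt 𝓘(ℝ, ℝ) 𝓘(ℝ, E) γ (Icc a t) s
      ((1 : ℝ →L[ℝ] ℝ).smulRight (γ' s))) :
    Manifold.riemannianEDist 𝓘(ℝ, E) (γ a) (γ t) ≤ ∫⁻ s in Icc a t, ‖γ' s‖ₑ :=
  (Manifold.riemannianEDist_le_pathELength hγ rfl rfl hat.le).trans_eq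
    (pathELength_eq_lintegral_of_hasMFDerivWithinAt hat hγ')

variable [IsManifold 𝓘(ℝ, E) ∞ M]
  [IsContMDiffRiemannianBundle 𝓘(ℝ, E) ∞ E (fun x : M ↦ TangentSpace 𝓘(ℝ, E) x)]

theorem SmoothTimeDepField.continuousOn_inner {X Y : ℝ → (m : M) → TangentSpace 𝓘(ℝ, E) m}
    {J : Set ℝ} (hX : SmoothTimeDepField J X) (hY : SmoothTimeDepField J Y) {p : ℝ → M}
    (hp : ContinuousOn p J) : ContinuousOn (fun s ↦ inner ℝ (X s (p s)) (Y s (p s))) J := by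
  have hsec {Z : ℝ → (m : M) → TangentSpace 𝓘(ℝ, E) m} (hZ : SmoothTimeDepField J Z) :
      ContinuousOn (fun s ↦ (⟨p s, Z s (p s)⟩ : TangentBundle 𝓘(ℝ, E) M)) J :=
    hZ.continuousOn.comp (f := fun s ↦ (s, p s)) (continuousOn_id.prodMk hp)
      fun s hs ↦ ⟨hs, mem_univ _⟩
  have : IsContinuousRiemannianBundle E (fun x : M ↦ TangentSpace 𝓘(ℝ, E) x) := by
    obtain ⟨g, hg, hg'⟩ := IsContMDiffRiemannianBundle.exists_contMDiff (IB := 𝓘(ℝ, E)) (n := ∞)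
      (F := E) (E := fun x : M ↦ TangentSpace 𝓘(ℝ, E) x)
    exact ⟨g, hg.continuous, hg'⟩
  exact ContinuousOn.inner_bundle (F := E) (E := fun x : M ↦ TangentSpace 𝓘(ℝ, E) x)
    (hsec hX) (hsec hY)

theorem SmoothTimeDepField.continuousOn_norm {X : ℝ → (m : M) → TangentSpace 𝓘(ℝ, E) m}
    {J : Set ℝ} (hX : SmoothTimeDepField J X) {p : ℝ → M} (hp : ContinuousOn p J) :
    ContinuousOn (fun s ↦ ‖X s (p s)‖) J := by
  refine (hX.continuousOn_inner hX hp).sqrt.congr fun s _ ↦ ?_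
  simp only [real_inner_self_eq_norm_sq]
  rw [Real.sqrt_sq (norm_nonneg _)]

theorem SmoothTimeDepField.continuousOn_norm_sub {X Y : ℝ → (m : M) → TangentSpace 𝓘(ℝ, E) m}
    {J : Set ℝ} (hX : SmoothTimeDepField J X) (hY : SmoothTimeDepField J Y) {p : ℝ → M}
    (hp : ContinuousOn p J) : ContinuousOn (fun s ↦ ‖X s (p s) - Y s (p s)‖) J := by
  refine (((hX.continuousOn_inner hX hp).sub ((hX.continuousOn_inner hY hp).const_mul 2)).add
    (hY.continuousOn_inner hY hp)).sqrt.congr fun s _ ↦ ?_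
  have h3 := norm_sub_sq_real (F := TangentSpace 𝓘(ℝ, E) (p s)) (X s (p s)) (Y s (p s))
  simp only [Pi.add_apply, Pi.sub_apply, real_inner_self_eq_norm_sq]
  rw [← h3, Real.sqrt_sq (norm_nonneg _)]

/-- The exponential factor is bounded by its supremum, which is then pulled out of the integral. No
measurability is needed of the rate `N`. -/
theorem lintegral_ennExp_mul_le {M : Type*} {N : ℝ → M → ℝ≥0∞} {q : ℝ → ℝ → M} {f : ℝ → ℝ≥0∞}
    {f₀ : ℝ → ℝ} {t : ℝ} (hf₀ : ContinuousOn f₀ (Icc 0 t)) (hf : ∀ s, ENNReal.ofReal (f₀ s) = f s) :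
    ∫⁻ s in Icc 0 t, ennExp (∫⁻ r in Icc s t, N r (q r s)) * f s ≤
      ennExp (supIntegral N t) * ∫⁻ s in Icc 0 t, f s := by
  have hfm : AEMeasurable f (volume.restrict (Icc 0 t)) :=
    (hf₀.aemeasurable measurableSet_Icc).ennreal_ofReal.congr (.of_forall hf)
  rw [← lintegral_const_mul'' _ hfm]
  refine setLIntegral_mono' measurableSet_Icc fun s hs ↦ ?_
  gcongr
  refine ennExp_mono ?_
  exact (lintegral_mono_set (Icc_subset_Icc_left hs.1)).trans
    (lintegral_mono fun r ↦ le_iSup (N r) (q r s))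

variable [FiniteDimensional ℝ E] [T2Space M] {a b : ℝ} {X : ℝ → (m : M) → TangentSpace 𝓘(ℝ, E) m}

/-- The curve `s ↦ μ_{t,s}(p s)` connects `μ_{t,a}(p a)` to `p t`. Bounding its length compares
an arbitrary `C^1` curve `p` with the flow. -/
theorem riemannianEDist_timeDepFlow_le
    (hX : SmoothTimeDepField (Icc a b) X) (hXc : CompleteTimeDepField (Icc a b) X) {p : ℝ → M}
    (hp : ContMDiffOn 𝓘(ℝ, ℝ) 𝓘(ℝ, E) 1 p (Icc a b)) {p' : (s : ℝ) → TangentSpace 𝓘(ℝ, E) (p s)}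
    (hp' : ∀ s ∈ Icc a b, HasMFDerivWithinAt 𝓘(ℝ, ℝ) 𝓘(ℝ, E) p (Icc a b) s
      ((1 : ℝ →L[ℝ] ℝ).smulRight (p' s))) {t : ℝ} (hat : a < t) (htb : t ≤ b) :
    Manifold.riemannianEDist 𝓘(ℝ, E) (timeDepFlow (Icc a b) X t a (p a)) (p t) ≤
      ∫⁻ s in Icc a t, ennExp (∫⁻ r in Icc s t,
        nablaNorm (X r) (timeDepFlow (Icc a b) X r s (p s))) * ‖p' s - X s (p s)‖ₑ := by
  have hab : a < b := hat.trans_le htb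
  have hsub : Icc a t ⊆ Icc a b := Icc_subset_Icc_right htb
  have ht : t ∈ Icc a b := ⟨hat.le, htb⟩
  have hc (s : ℝ) (hs : s ∈ Icc a t) :=
    contMDiffWithinAt_timeDepFlow_curve hab hX hXc hp (hsub hs) ht (hp' s (hsub hs))
  have key := riemannianEDist_le_lintegral (γ := fun τ ↦ timeDepFlow (Icc a b) X t τ (p τ)) hat
    (fun s hs ↦ (hc s hs).1.mono hsub) (fun s hs ↦ (hc s hs).2.mono hsub)
  have h1 : timeDepFlow (Icc a b) X t t (p t) = p t := timeDepFlow_self hXc ht _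
  rw [h1] at key
  refine key.trans (setLIntegral_mono' measurableSet_Icc fun s hs ↦ ?_)
  exact enorm_mfderiv_timeDepFlow_le hab hX hXc hs.2 ht (hsub hs) (p s) (p' s - X s (p s))

end Estimates

theorem theorem1p7 {E : Type*} [NormedAddCommGroup E] [NormedSpace ℝ E] [FiniteDimensional ℝ E]
    {M : Type*} [TopologicalSpace M] [T2Space M] [SecondCountableTopology M] [ConnectedSpace M]
    [ChartedSpace E M] [IsManifold 𝓘(ℝ, E) ∞ M]
    [RiemannianBundle (fun x : M ↦ TangentSpace 𝓘(ℝ, E) x)]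
    [IsContMDiffRiemannianBundle 𝓘(ℝ, E) ∞ E (fun x : M ↦ TangentSpace 𝓘(ℝ, E) x)]
    (T : ℝ) (X Y : ℝ → (m : M) → TangentSpace 𝓘(ℝ, E) m)
    (hX : SmoothTimeDepField (Icc 0 T) X) (hXc : CompleteTimeDepField (Icc 0 T) X)
    (hY : SmoothTimeDepField (Icc 0 T) Y) (hYc : CompleteTimeDepField (Icc 0 T) Y)
    (m : M) (t : ℝ) (ht : 0 < t) (htT : t ≤ T) :
    let μX := timeDepFlow (Icc 0 T) X
    let μY := timeDepFlow (Icc 0 T) Y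
    let d := Manifold.riemannianEDist 𝓘(ℝ, E) (M := M)
    (d (μX t 0 m) (μY t 0 m) ≤
        ∫⁻ s in Icc 0 t, ennExp (∫⁻ r in Icc s t, nablaNorm (X r) (μX r s (μY s 0 m))) *
          ‖Y s (μY s 0 m) - X s (μY s 0 m)‖ₑ ∧
      ∫⁻ s in Icc 0 t, ennExp (∫⁻ r in Icc s t, nablaNorm (X r) (μX r s (μY s 0 m))) *
          ‖Y s (μY s 0 m) - X s (μY s 0 m)‖ₑ ≤
        ennExp (supIntegral (fun s x ↦ nablaNorm (X s) x) t) *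
          supIntegral (fun s x ↦ ‖Y s x - X s x‖ₑ) t) ∧
    (d (μY t 0 m) m ≤ ∫⁻ s in Icc 0 t, ‖Y s (μY s 0 m)‖ₑ ∧
      ∫⁻ s in Icc 0 t, ‖Y s (μY s 0 m)‖ₑ ≤ supIntegral (fun s x ↦ ‖Y s x‖ₑ) t) ∧
    (d (μY t 0 m) m ≤
        ∫⁻ s in Icc 0 t, ennExp (∫⁻ r in Icc s t, nablaNorm (Y r) (μY r s m)) * ‖Y s m‖ₑ ∧
      ∫⁻ s in Icc 0 t, ennExp (∫⁻ r in Icc s t, nablaNorm (Y r) (μY r s m)) * ‖Y s m‖ₑ ≤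
        ennExp (supIntegral (fun s x ↦ nablaNorm (Y s) x) t) * ∫⁻ s in Icc 0 t, ‖Y s m‖ₑ) := by
  intro μX μY d
  have h0T : 0 < T := ht.trans_le htT
  have h0 : (0 : ℝ) ∈ Icc 0 T := ⟨le_rfl, h0T.le⟩
  have hsub : Icc 0 t ⊆ Icc 0 T := Icc_subset_Icc_right htT
  have hγ : IsSolutionOn (Icc 0 T) Y (fun s ↦ μY s 0 m) := isSolutionOn_timeDepFlow hYc h0 m
  have hγ1 : ContMDiffOn 𝓘(ℝ, ℝ) 𝓘(ℝ, E) 1 (fun s ↦ μY s 0 m) (Icc 0 T) := hγ.contMDiffOn h0T hY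
  have hμ0 : μY 0 0 m = m := timeDepFlow_self hYc h0 m
  refine ⟨⟨?_, ?_⟩, ⟨?_, ?_⟩, ?_, ?_⟩
  -- the trajectory of `Y` compared with the flow of `X`
  · have := riemannianEDist_timeDepFlow_le hX hXc hγ1 hγ ht htT
    rwa [hμ0] at this
  · refine (lintegral_ennExp_mul_le (N := fun s x ↦ nablaNorm (X s) x)
      (q := fun r s ↦ μX r s (μY s 0 m)) ((hY.continuousOn_norm_sub hX hγ1.continuousOn).mono hsub)
      fun s ↦ ofReal_norm _).trans ?_
    gcongr
    exact lintegral_mono fun s ↦ le_iSup (fun x ↦ ‖Y s x - X s x‖ₑ) (μY s 0 m)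
  · have := riemannianEDist_le_lintegral ht (hγ1.mono hsub) fun s hs ↦ (hγ s (hsub hs)).mono hsub
    rw [hμ0, Manifold.riemannianEDist_comm] at this
    exact this
  · exact lintegral_mono fun s ↦ le_iSup (fun x ↦ ‖Y s x‖ₑ) (μY s 0 m)
  -- a constant curve compared with the flow of `Y`
  · have := riemannianEDist_timeDepFlow_le hY hYc (p := fun _ ↦ m) (p' := fun _ ↦ 0)
      contMDiffOn_const (fun s _ ↦ ?_) ht htT
    · simpa only [zero_sub, enorm_neg] using this
    · refine (hasMFDerivWithinAt_const m (Icc 0 T) s).congr_mfderiv ?_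
      exact ContinuousLinearMap.ext fun (c : ℝ) ↦ (smul_zero (A := E) c).symm
  · exact lintegral_ennExp_mul_le (N := fun s x ↦ nablaNorm (Y s) x) (q := fun r s ↦ μY r s m)
      ((hY.continuousOn_norm (continuousOn_const (c := m))).mono hsub) fun s ↦ ofReal_norm _
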